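/- Let $C>10^{10}$ be a real number and let $G$ be a finite simple graph on $n\geq 3$ vertices that is a $C$-expander, that is: (a) $|N(X)|\geq C|X|$ for every $X\subseteq V(G)$ with $|X|<\frac{n}{2C}$, where $N(X)$ is the set of vertices outside $X$ that have a neighbour in $X$; and (b) there is an edge of $G$ between any two disjoint sets $X,Y\subseteq V(G)$ with $|X|,|Y|\geq \frac{n}{2C}$. Then $G$ contains a spanning linear forest (a subgraph with vertex set $V(G)$ that is a disjoint union of paths) that has at most $n^{0.8}$ paths and no isolated vertices. -/

import Mathlib

/-- The outer neighbourhood `N_G(X)`: the vertices outside `X` that are adjacent to at least one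
vertex of `X`. -/
def SimpleGraph.outerNeighborSet {V : Type*} (G : SimpleGraph V) (X : Set V) : Set V :=
  {v | v ∉ X ∧ ∃ x ∈ X, G.Adj x v}

/-- A `C`-expander: a finite graph on `n ≥ 3` vertices in which every set `X` of fewer than
`n / (2C)` vertices has at least `C |X|` outer neighbours, and in which there is an edge between
any two disjoint sets of at least `n / (2C)` vertices each. -/
structure SimpleGraph.IsExpander {V : Type*} [Fintype V] (G : SimpleGraph V) (C : ℝ) : Prop where
  three_le_card : 3 ≤ Fintype.card V
  expansion : ∀ X : Set V, (X.ncard : ℝ) < Fintype.card V / (2 * C) →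
    C * X.ncard ≤ (G.outerNeighborSet X).ncard
  exists_adj : ∀ X Y : Set V, Disjoint X Y →
    (Fintype.card V : ℝ) / (2 * C) ≤ X.ncard → (Fintype.card V : ℝ) / (2 * C) ≤ Y.ncard →
    ∃ x ∈ X, ∃ y ∈ Y, G.Adj x y

/-- A (finite) linear forest: every connected component is a path, possibly consisting of a single
vertex (`SimpleGraph.pathGraph k` is the path with `k` vertices). The number of paths of a linear
forest `F` is the number of its connected components. -/
def SimpleGraph.IsLinearForest {V : Type*} (F : SimpleGraph V) : Prop :=
  ∀ c : F.ConnectedComponent, ∃ k : ℕ, Nonempty (c.toSimpleGraph ≃g SimpleGraph.pathGraph k)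

/-! Among the path forests in `G`, take one, `F`, with the most edges and, subject to this, the
largest sum of square roots of the component sizes (`IsOptimal`). Both conclusions hold for this
`F`, by rotations: if `z` ends a path and `zy` is an edge of `G`, replace a forest edge `yw` by
`zy`, so that `w` becomes an end.

Number of paths. If there are k paths on n vertices, at least half have at most l = 2n/k vertices.
Starting from their ends, s successive rotations reach new ends of paths with at most 100^s l
vertices: cutting off anything longer on both sides of `y` would raise the sum of square roots too
much (`IsOptimal.exists_rotate`). These new ends stay close to the ends of the paths of `F`
(`shallow_of_compSize_rotate_le`), so each path holds few of them.

Two forests rerouted inside complementary sets `A`, `Aᶜ` of components can be glued, and then an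
edge of `G` between their new ends would give one edge too many (`IsOptimal.not_adj_of_isReroute`).
So it suffices to find an `A` for which both sides reach n/(2C) ends. For random `A` this is a
percolation statement: the family of bad sets is down-closed, and on such a family about half of
each expanding neighbourhood falls in blocks of `A`, up to a first-level Fourier error
(`exists_le_card_and_le_card_compl`). The error is affordable when n³ ≤ k⁴, which k > n^0.8 implies.

Isolated vertices. Rotating from an isolated vertex must isolate another vertex, by optimality. A
maximal set of vertices that can be isolated in this way is independent in `G` and has at most three
times as many neighbours as elements, which an expander forbids. -/

/-! ### Percolation on a random set of blocks -/

section Percolation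

open Finset

variable {β : Type*} [Fintype β] [DecidableEq β]

/-- The sign of `b` in `A`: `1` if `b ∈ A` and `-1` otherwise. -/
noncomputable def memSign (b : β) (A : Finset β) : ℝ := if b ∈ A then 1 else -1

/-- Toggling `b` pairs up the sets with opposite signs and equal values of `g`. -/
theorem sum_memSign_mul_eq_zero (b : β) (g : Finset β → ℝ)
    (hg : ∀ A, g (insert b A) = g (A.erase b)) : ∑ A, memSign b A * g A = 0 := by
  refine Finset.sum_involution (fun A _ => if b ∈ A then A.erase b else insert b A) ?_ ?_ ?_ ?_
  · intro A _
    by_cases h : b ∈ A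
    · have := hg A
      rw [insert_eq_of_mem h] at this
      simp [memSign, h, this]
    · have := hg A
      rw [erase_eq_of_notMem h] at this
      simp [memSign, h, this]
  · intro A _ _
    by_cases h : b ∈ A
    · simp only [h, if_true]
      intro h'
      rw [← h'] at h
      simp at h
    · simp only [h, if_false]
      intro h'
      rw [← h'] at h
      simp at h
  · intro A _; simp
  · intro A _
    by_cases h : b ∈ A
    · simp [h]
    · simp [h]

/-- Parseval: distinct signs are orthogonal, by toggling one of the two blocks. -/
theorem sum_sq_sum_memSign (lam : β → ℝ) :
    ∑ A : Finset β, (∑ b, memSign b A * lam b) ^ 2 = 2 ^ Fintype.card β * ∑ b, lam b ^ 2 := by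
  have h1 : ∀ A : Finset β, (∑ b, memSign b A * lam b) ^ 2 =
      ∑ b, ∑ c, memSign b A * (memSign c A * lam b * lam c) := by
    intro A
    rw [sq, Finset.sum_mul_sum]
    exact sum_congr rfl fun b _ => sum_congr rfl fun c _ => by ring
  simp_rw [h1]
  rw [sum_comm, mul_sum]
  refine sum_congr rfl fun b _ => ?_
  rw [sum_comm, sum_eq_single b]
  · have : ∀ A : Finset β, memSign b A * (memSign b A * lam b * lam b) = lam b ^ 2 := by
      intro A
      by_cases h : b ∈ A <;> simp [memSign, h] <;> ring
    simp [this]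
  · intro c _ hc
    apply sum_memSign_mul_eq_zero
    intro A
    simp [memSign, hc]
  · simp

/-- Cauchy–Schwarz over `D` and Parseval: a weighted sum of the first-level Fourier coefficients of
any family is small. -/
theorem sum_sum_memSign_le (D : Finset (Finset β)) (lam : β → ℝ) :
    ∑ A ∈ D, ∑ b, memSign b A * lam b ≤ 2 ^ Fintype.card β * √(∑ b, lam b ^ 2) := by
  have h1 : (∑ A ∈ D, ∑ b, memSign b A * lam b) ^ 2 ≤
      (2 ^ Fintype.card β * √(∑ b, lam b ^ 2)) ^ 2 := by
    calc (∑ A ∈ D, ∑ b, memSign b A * lam b) ^ 2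
        ≤ #D * ∑ A ∈ D, (∑ b, memSign b A * lam b) ^ 2 := sq_sum_le_card_mul_sum_sq
      _ ≤ 2 ^ Fintype.card β * ∑ A : Finset β, (∑ b, memSign b A * lam b) ^ 2 := by
          gcongr
          · have := card_le_univ D
            rw [Fintype.card_finset] at this
            exact_mod_cast this
          · exact subset_univ D
      _ = _ := by
          rw [sum_sq_sum_memSign, mul_pow, Real.sq_sqrt (sum_nonneg fun b _ => sq_nonneg _)]
          ring
  exact le_of_sq_le_sq h1 (by positivity)

variable {V : Type*}

/-- For a down-closed family `D` of subsets of a finite type of blocks and a monotone family of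
vertex sets `Γ A`, on average over `D` at most half of `Γ A` lies in blocks outside of `A`, up to an
error controlled by the numbers of vertices in single blocks. -/
theorem sum_card_filter_notMem_le (bl : V → β) (D : Finset (Finset β))
    (hD : ∀ A b, insert b A ∈ D → A ∈ D) (Γ : Finset β → Finset V) (hΓ : Monotone Γ)
    (lam : β → ℝ) (hlam : ∀ A b, (#{v ∈ Γ A | bl v = b} : ℝ) ≤ lam b) :
    ∑ A ∈ D, (#{v ∈ Γ A | bl v ∉ A} : ℝ) ≤
      ∑ A ∈ D, (#{v ∈ Γ A | bl v ∈ A} : ℝ) + 2 ^ Fintype.card β * √(∑ b, lam b ^ 2) := by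
  set w : β → Finset β → ℝ := fun b A => (#{v ∈ Γ A | bl v = b} : ℝ) with hw
  have hwmono : ∀ b A B, A ⊆ B → w b A ≤ w b B := by
    intro b A B h
    simp only [hw]
    exact_mod_cast card_le_card (filter_subset_filter _ (hΓ h))
  have hout : ∀ A, (#{v ∈ Γ A | bl v ∉ A} : ℝ) = ∑ b, if b ∈ A then 0 else w b A := by
    intro A
    rw [card_eq_sum_card_fiberwise (f := bl) (t := univ) (by simp)]
    push_cast
    refine sum_congr rfl fun b _ => ?_
    by_cases h : b ∈ A
    · simp only [h, if_true, Nat.cast_eq_zero, card_eq_zero, filter_filter]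
      apply filter_eq_empty_iff.2
      rintro v _ ⟨h1, h2⟩
      exact h1 (h2 ▸ h)
    · simp only [h, if_false, hw, filter_filter]
      congr 2
      ext v
      simp only [mem_filter]
      constructor
      · rintro ⟨a, b, c⟩; exact ⟨a, c⟩
      · rintro ⟨a, c⟩; exact ⟨a, c ▸ h, c⟩
  have hin : ∀ A, (#{v ∈ Γ A | bl v ∈ A} : ℝ) = ∑ b, if b ∈ A then w b A else 0 := by
    intro A
    rw [card_eq_sum_card_fiberwise (f := bl) (t := univ) (by simp)]
    push_cast
    refine sum_congr rfl fun b _ => ?_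
    by_cases h : b ∈ A
    · simp only [h, if_true, hw, filter_filter]
      congr 2
      ext v
      simp only [mem_filter]
      constructor
      · rintro ⟨a, b, c⟩; exact ⟨a, c⟩
      · rintro ⟨a, c⟩; exact ⟨a, c ▸ h, c⟩
    · simp only [h, if_false, Nat.cast_eq_zero, card_eq_zero, filter_filter]
      apply filter_eq_empty_iff.2
      rintro v _ ⟨h1, h2⟩
      exact h (h2 ▸ h1)
  have key : ∀ b, ∑ A ∈ D, (if b ∈ A then 0 else w b A) ≤
      ∑ A ∈ D, (if b ∈ A then w b A else 0) + ∑ A ∈ D, memSign b A * (-lam b) := by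
    intro b
    have hie : ∀ A : Finset β, insert b (A.erase b) = insert b A := by
      intro A; ext x; by_cases hxb : x = b <;> simp [hxb]
    -- Compare `A.erase b` with `insert b A`. If both lie in `D`, monotonicity suffices; if only the
    -- smaller does, the cost is `lam b`, and such pairs are counted by the Fourier coefficient of
    -- `D` at `b`. Adding two vanishing sums makes this a termwise inequality.
    have z1 := sum_memSign_mul_eq_zero b
      (fun A => w b (A.erase b) * (if insert b A ∈ D then 1 else 0)) (by intro A; simp [hie])
    have z2 := sum_memSign_mul_eq_zero b
      (fun A => lam b * (if insert b A ∈ D then 1 else 0)) (by intro A; simp [hie])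
    have hind : ∀ f : Finset β → ℝ, ∑ A ∈ D, f A = ∑ A, (if A ∈ D then f A else 0) := by
      intro f; rw [← sum_filter]; congr 1; ext; simp
    rw [hind, hind, hind]
    suffices h : ∑ A, (if A ∈ D then (if b ∈ A then 0 else w b A) else 0) ≤
        ∑ A, (((if A ∈ D then (if b ∈ A then w b A else 0) else 0) +
          (if A ∈ D then memSign b A * (-lam b) else 0)) +
          (memSign b A * (lam b * (if insert b A ∈ D then 1 else 0)) -
          memSign b A * (w b (A.erase b) * (if insert b A ∈ D then 1 else 0)))) by
      rw [sum_add_distrib, sum_add_distrib, sum_sub_distrib, z1, z2] at h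
      linarith
    refine sum_le_sum fun A _ => ?_
    by_cases hb : b ∈ A
    · have h1 := hwmono b _ _ (erase_subset b A)
      by_cases hA : A ∈ D
      · simp only [hA, hb, memSign, if_true, insert_eq_of_mem]; linarith
      · simp [hA, hb, memSign]
    · have h1 := hlam A b
      change w b A ≤ lam b at h1
      by_cases hA : A ∈ D
      · by_cases hi : insert b A ∈ D
        · simp [hA, hb, hi, memSign]
        · simp [hA, hb, hi, memSign, h1]
      · have hi : insert b A ∉ D := fun h => hA (hD _ _ h)
        simp [hA, hb, hi, memSign]
  calc ∑ A ∈ D, (#{v ∈ Γ A | bl v ∉ A} : ℝ)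
      = ∑ b, ∑ A ∈ D, (if b ∈ A then 0 else w b A) := by
        rw [sum_comm]; exact sum_congr rfl fun A _ => hout A
    _ ≤ ∑ b, (∑ A ∈ D, (if b ∈ A then w b A else 0) + ∑ A ∈ D, memSign b A * (-lam b)) :=
        sum_le_sum fun b _ => key b
    _ = ∑ A ∈ D, (#{v ∈ Γ A | bl v ∈ A} : ℝ) + ∑ A ∈ D, ∑ b, memSign b A * (-lam b) := by
        rw [sum_add_distrib, sum_comm, sum_comm (s := univ)]
        congr 1
        exact sum_congr rfl fun A _ => (hin A).symm
    _ ≤ _ := by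
        have := sum_sum_memSign_le D (fun b => -lam b)
        simp only [neg_sq] at this
        linarith

/-- Growth inside a random set of blocks: if the sets `U s A` grow in every step by the vertices of
`Γ s A` that lie in blocks of `A`, and `Γ s A` is much larger than `U s A` as long as the latter is
small, then some set `A` of blocks and its complement both carry large sets `U t A`, `U t Aᶜ`. -/
theorem exists_le_card_and_le_card_compl (bl : V → β) (t : ℕ) (U Γ : ℕ → Finset β → Finset V)
    (C M : ℝ) (hC : 600 ≤ C) (hUA : Monotone (U t)) (hUs : ∀ s ≤ t, ∀ A, U s A ⊆ U t A)
    (hΓ : ∀ s < t, Monotone (Γ s))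
    (hin : ∀ s < t, ∀ A, #{v ∈ Γ s A | bl v ∈ A} ≤ 3 * #(U (s + 1) A))
    (lam : β → ℝ) (hlam : ∀ s < t, ∀ A b, (#{v ∈ Γ s A | bl v = b} : ℝ) ≤ lam b)
    (hexp : ∀ s < t, ∀ A, (#(U s A) : ℝ) < M → C * #(U s A) ≤ #(Γ s A))
    (X : Finset β) (hX : ∀ A, #(X ∩ A) ≤ #(U 0 A)) (hX100 : 100 ≤ #X)
    (hlamX : √(∑ b, lam b ^ 2) ≤ (C - 600) * (#X / 5)) (hM : M ≤ 100 ^ t * (#X / 5)) :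
    ∃ A, M ≤ #(U t A) ∧ M ≤ #(U t Aᶜ) := by
  by_contra! hcon
  set D : Finset (Finset β) := {A | (#(U t A) : ℝ) < M} with hDdef
  have hDmem : ∀ A, A ∈ D ↔ (#(U t A) : ℝ) < M := by simp [hDdef]
  have hdown : ∀ A b, insert b A ∈ D → A ∈ D := by
    intro A b h
    rw [hDmem] at h ⊢
    refine lt_of_le_of_lt ?_ h
    exact_mod_cast card_le_card (hUA (subset_insert b A))
  set Q : ℝ := 2 ^ Fintype.card β with hQ
  have hQpos : 0 < Q := by positivity
  -- By `hcon`, of `A` and `Aᶜ` at least one lies in `D`.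
  have hDhalf : Q ≤ 2 * #D := by
    have h1 : (univ : Finset (Finset β)) ⊆ D ∪ D.image compl := by
      intro A _
      rw [mem_union, mem_image]
      by_cases hA : A ∈ D
      · exact Or.inl hA
      · right
        refine ⟨Aᶜ, ?_, compl_compl A⟩
        rw [hDmem] at hA ⊢
        exact hcon A (not_lt.1 hA)
    have h2 := (card_le_card h1).trans (card_union_le _ _)
    have h3 := card_image_le (s := D) (f := compl)
    rw [card_univ, Fintype.card_finset] at h2
    have h4 : 2 ^ Fintype.card β ≤ 2 * #D := by omega
    rw [hQ]; exact_mod_cast h4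
  set E : ℕ → ℝ := fun s => ∑ A ∈ D, (#(U s A) : ℝ) with hE
  set x : ℝ := (#X : ℝ) with hx
  have hx100 : (100 : ℝ) ≤ x := by rw [hx]; exact_mod_cast hX100
  -- The Fourier bound with weight on `X` gives #D·x - 2·E 0 ≤ Q√x ≤ Qx/10. With #D ≥ Q/2, this
  -- leaves E 0 ≥ Qx/5.
  have hE0 : Q * (x / 5) ≤ E 0 := by
    have h1 := sum_sum_memSign_le D (fun b => if b ∈ X then -1 else 0)
    have h2 : ∀ A : Finset β, ∑ b, memSign b A * (if b ∈ X then -1 else 0) =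
        x - 2 * #(X ∩ A) := by
      intro A
      have h5 : ∀ b, memSign b A * (if b ∈ X then (-1 : ℝ) else 0) =
          (if b ∈ X then 1 else 0) - 2 * (if b ∈ X ∩ A then 1 else 0) := by
        intro b
        by_cases h : b ∈ X <;> by_cases h' : b ∈ A <;> simp [memSign, h, h'] ; norm_num
      simp_rw [h5]
      rw [sum_sub_distrib, ← mul_sum, sum_boole, sum_boole, filter_univ_mem, filter_univ_mem]
    have h3 : ∑ b, (if b ∈ X then (-1 : ℝ) else 0) ^ 2 = x := by
      simp [hx, ite_pow]
    simp_rw [h2] at h1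
    rw [h3, sum_sub_distrib, ← mul_sum] at h1
    simp only [sum_const, nsmul_eq_mul] at h1
    have h4 : ∑ A ∈ D, (#(X ∩ A) : ℝ) ≤ E 0 :=
      sum_le_sum fun A _ => by exact_mod_cast hX A
    have h6 : √x ≤ x / 10 := by
      rw [Real.sqrt_le_left (by linarith)]
      nlinarith
    have h7 : Q * √x ≤ Q * (x / 10) := by gcongr
    have h8 : Q * x ≤ 2 * #D * x := by gcongr
    linarith
  have hstep : ∀ s < t, C * E s ≤ 6 * E (s + 1) + Q * √(∑ b, lam b ^ 2) := by
    intro s hs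
    have h1 := sum_card_filter_notMem_le bl D hdown (Γ s) (hΓ s hs) lam (hlam s hs)
    have h2 : ∑ A ∈ D, (#{v ∈ Γ s A | bl v ∈ A} : ℝ) ≤ 3 * E (s + 1) := by
      rw [hE, mul_sum]
      exact sum_le_sum fun A _ => by exact_mod_cast hin s hs A
    have h3 : C * E s ≤
        ∑ A ∈ D, ((#{v ∈ Γ s A | bl v ∈ A} : ℝ) + #{v ∈ Γ s A | bl v ∉ A}) := by
      rw [hE, mul_sum]
      refine sum_le_sum fun A hA => ?_
      have h4 : (#{v ∈ Γ s A | bl v ∈ A} : ℝ) + #{v ∈ Γ s A | bl v ∉ A} = #(Γ s A) := by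
        exact_mod_cast card_filter_add_card_filter_not (s := Γ s A) (fun v => bl v ∈ A)
      rw [h4]
      apply hexp s hs
      refine lt_of_le_of_lt ?_ ((hDmem A).1 hA)
      exact_mod_cast card_le_card (hUs s hs.le A)
    rw [sum_add_distrib] at h3
    linarith
  -- The error is at most (C - 600)·E s, so 600·E s ≤ 6·E (s + 1): growth by 100 in each step.
  have hgrow : ∀ s ≤ t, 100 ^ s * (Q * (x / 5)) ≤ E s := by
    intro s
    induction s with
    | zero => intro _; simpa using hE0
    | succ s ih =>
      intro hs
      have h1 := ih (by omega)
      have h2 := hstep s (by omega)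
      have h3 : Q * √(∑ b, lam b ^ 2) ≤ Q * ((C - 600) * (x / 5)) := by gcongr
      have h4 : Q * (x / 5) ≤ 100 ^ s * (Q * (x / 5)) :=
        le_mul_of_one_le_left (by positivity) (one_le_pow₀ (by norm_num))
      have h5 : (C - 600) * (Q * (x / 5)) ≤ (C - 600) * E s :=
        mul_le_mul_of_nonneg_left (h4.trans h1) (by linarith)
      rw [pow_succ]
      linarith
  have hfin := hgrow t le_rfl
  have hDne : D.Nonempty := by
    rw [nonempty_iff_ne_empty]; rintro h
    rw [h] at hDhalf; simp at hDhalf; linarith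
  have hEt : E t < #D * M := by
    rw [← nsmul_eq_mul, ← sum_const]
    exact sum_lt_sum_of_nonempty hDne fun A hA => (hDmem A).1 hA
  have hDQ : (#D : ℝ) ≤ Q := by
    have := card_le_univ D
    rw [Fintype.card_finset] at this
    rw [hQ]; exact_mod_cast this
  have hM0 : 0 ≤ M := by
    obtain ⟨A, hA⟩ := hDne
    exact (Nat.cast_nonneg _).trans ((hDmem A).1 hA).le
  have : #D * M ≤ Q * (100 ^ t * (x / 5)) := by gcongr
  linarith

end Percolation

namespace SimpleGraph

/-! ### Components and degrees when an edge is added -/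

section Basics

variable {V : Type*}

/-- The number of vertices in the connected component of `v`. -/
noncomputable def compSize (F : SimpleGraph V) (v : V) : ℕ := {x | F.Reachable v x}.ncard

/-- The number of neighbours of `v`. -/
noncomputable def ndeg (F : SimpleGraph V) (v : V) : ℕ := (F.neighborSet v).ncard

/-- A forest of paths in `G`: an acyclic subgraph in which every degree is at most two. -/
structure IsPathForest (G F : SimpleGraph V) : Prop where
  le : F ≤ G
  acyclic : F.IsAcyclic
  ndeg_le : ∀ v, F.ndeg v ≤ 2

theorem reachable_sup_edge {H : SimpleGraph V} {a b x y : V} (hab : a ≠ b) :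
    (H ⊔ edge a b).Reachable x y ↔ H.Reachable x y ∨ (H.Reachable x a ∧ H.Reachable b y) ∨
      (H.Reachable x b ∧ H.Reachable a y) := by
  have hmono : ∀ {p q}, H.Reachable p q → (H ⊔ edge a b).Reachable p q :=
    fun h => h.mono le_sup_left
  have hadj : (H ⊔ edge a b).Reachable a b := Adj.reachable (by simp [edge_adj, hab])
  constructor
  · rintro ⟨p⟩
    induction p with
    | nil => exact Or.inl (Reachable.refl _)
    | @cons u v w h p ih =>
      rw [sup_adj, edge_adj] at h
      rcases h with h | ⟨⟨rfl, rfl⟩ | ⟨rfl, rfl⟩, _⟩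
      · rcases ih with ih | ⟨h1, h2⟩ | ⟨h1, h2⟩
        · exact Or.inl (h.reachable.trans ih)
        · exact Or.inr (Or.inl ⟨h.reachable.trans h1, h2⟩)
        · exact Or.inr (Or.inr ⟨h.reachable.trans h1, h2⟩)
      · rcases ih with ih | ⟨h1, h2⟩ | ⟨h1, h2⟩
        · exact Or.inr (Or.inl ⟨Reachable.refl _, ih⟩)
        · exact Or.inr (Or.inl ⟨Reachable.refl _, h2⟩)
        · exact Or.inl h2
      · rcases ih with ih | ⟨h1, h2⟩ | ⟨h1, h2⟩
        · exact Or.inr (Or.inr ⟨Reachable.refl _, ih⟩)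
        · exact Or.inl h2
        · exact Or.inr (Or.inr ⟨Reachable.refl _, h2⟩)
  · rintro (h | ⟨h1, h2⟩ | ⟨h1, h2⟩)
    · exact hmono h
    · exact (hmono h1).trans (hadj.trans (hmono h2))
    · exact (hmono h1).trans (hadj.symm.trans (hmono h2))

theorem compSize_congr {F : SimpleGraph V} {u v : V} (h : F.Reachable u v) :
    F.compSize u = F.compSize v := by
  unfold compSize
  congr 1
  ext x
  exact ⟨fun h' => h.symm.trans h', fun h' => h.trans h'⟩

theorem compSize_sup_edge_of_not_reachable {H : SimpleGraph V} {a b x : V} (hne : a ≠ b)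
    (ha : ¬ H.Reachable a x) (hb : ¬ H.Reachable b x) :
    (H ⊔ edge a b).compSize x = H.compSize x := by
  unfold compSize
  congr 1
  ext y
  simp only [Set.mem_ofPred_eq, reachable_sup_edge hne]
  constructor
  · rintro (h | ⟨h1, h2⟩ | ⟨h1, h2⟩)
    · exact h
    · exact absurd h1.symm ha
    · exact absurd h1.symm hb
  · exact Or.inl

theorem sup_edge_deleteEdges {F : SimpleGraph V} {y w : V} (h : F.Adj y w) :
    F.deleteEdges {s(y, w)} ⊔ edge y w = F := by
  ext u v
  simp only [sup_adj, deleteEdges_adj, Set.mem_singleton_iff, Sym2.eq_iff, edge_adj]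
  constructor
  · rintro (⟨h, _⟩ | ⟨⟨rfl, rfl⟩ | ⟨rfl, rfl⟩, _⟩)
    · exact h
    · exact h
    · exact h.symm
  · intro h'
    have := h'.ne
    tauto

theorem IsAcyclic.not_reachable_deleteEdges {F : SimpleGraph V} (hF : F.IsAcyclic) {y w : V}
    (h : F.Adj y w) : ¬ (F.deleteEdges {s(y, w)}).Reachable y w := by
  have := isAcyclic_iff_forall_adj_isBridge.1 hF h
  rw [isBridge_iff] at this
  exact this

variable [Finite V]

theorem compSize_pos (F : SimpleGraph V) (v : V) : 0 < F.compSize v :=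
  (Set.ncard_pos (Set.toFinite _)).2 ⟨v, Reachable.refl v⟩

theorem compSize_sup_edge_of_reachable {H : SimpleGraph V} {a b x : V} (hab : ¬ H.Reachable a b)
    (hx : H.Reachable a x ∨ H.Reachable b x) :
    (H ⊔ edge a b).compSize x = H.compSize a + H.compSize b := by
  have hne : a ≠ b := fun h => hab (h ▸ Reachable.refl a)
  unfold compSize
  rw [← Set.ncard_union_eq ?_ (Set.toFinite _) (Set.toFinite _)]
  · congr 1
    ext y
    simp only [Set.mem_ofPred_eq, Set.mem_union, reachable_sup_edge hne]
    rcases hx with hx | hx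
    · constructor
      · rintro (h | ⟨h1, h2⟩ | ⟨h1, h2⟩)
        · exact Or.inl (hx.trans h)
        · exact Or.inr h2
        · exact Or.inl h2
      · rintro (h | h)
        · exact Or.inl (hx.symm.trans h)
        · exact Or.inr (Or.inl ⟨hx.symm, h⟩)
    · constructor
      · rintro (h | ⟨h1, h2⟩ | ⟨h1, h2⟩)
        · exact Or.inr (hx.trans h)
        · exact Or.inr h2
        · exact Or.inl h2
      · rintro (h | h)
        · exact Or.inr (Or.inr ⟨hx.symm, h⟩)
        · exact Or.inl (hx.symm.trans h)
  · rw [Set.disjoint_left]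
    intro y h1 h2
    exact hab (h1.trans h2.symm)

open Classical in
theorem ndeg_sup_edge {H : SimpleGraph V} {a b : V} (hab : ¬ H.Adj a b) (hne : a ≠ b) (v : V) :
    (H ⊔ edge a b).ndeg v = H.ndeg v + ((if v = a then 1 else 0) + (if v = b then 1 else 0)) := by
  unfold ndeg
  by_cases hva : v = a
  · subst hva
    have : (H ⊔ edge v b).neighborSet v = insert b (H.neighborSet v) := by
      ext y
      simp only [mem_neighborSet, sup_adj, edge_adj, Set.mem_insert_iff]
      grind
    rw [this, Set.ncard_insert_of_notMem (by simpa using hab)]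
    simp [hne]
  by_cases hvb : v = b
  · subst hvb
    have : (H ⊔ edge a v).neighborSet v = insert a (H.neighborSet v) := by
      ext y
      simp only [mem_neighborSet, sup_adj, edge_adj, Set.mem_insert_iff]
      grind
    rw [this, Set.ncard_insert_of_notMem (by simpa using fun h => hab h.symm)]
    simp [hva]
  · have : (H ⊔ edge a b).neighborSet v = H.neighborSet v := by
      ext y
      simp only [mem_neighborSet, sup_adj, edge_adj]
      grind
    rw [this]
    simp [hva, hvb]

end Basics

/-! ### The two quantities to be maximized -/

section Sums

variable {V : Type*} [Fintype V]

/-- The sum of the degrees. -/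
noncomputable def degSum (F : SimpleGraph V) : ℕ := ∑ v, F.ndeg v

/-- The sum of the square roots of the sizes of the connected components. -/
noncomputable def sqrtSum (F : SimpleGraph V) : ℝ := ∑ v, (√(F.compSize v : ℝ))⁻¹

theorem degSum_sup_edge {H : SimpleGraph V} {a b : V} (hab : ¬ H.Adj a b) (hne : a ≠ b) :
    (H ⊔ edge a b).degSum = H.degSum + 2 := by
  classical
  unfold degSum
  simp_rw [ndeg_sup_edge hab hne, Finset.sum_add_distrib]
  simp

/-- A component with m vertices contributes m·(1/√m) = √m, and the new edge merges two components.
-/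
theorem sqrtSum_sup_edge {H : SimpleGraph V} {a b : V} (hab : ¬ H.Reachable a b) :
    (H ⊔ edge a b).sqrtSum = H.sqrtSum - √(H.compSize a) - √(H.compSize b) +
      √(H.compSize a + H.compSize b) := by
  classical
  have hne : a ≠ b := fun h => hab (h ▸ Reachable.refl a)
  set m : ℝ := (√((H.compSize a : ℝ) + H.compSize b))⁻¹ with hm
  have hpt : ∀ v, (√((H ⊔ edge a b).compSize v : ℝ))⁻¹ = (√(H.compSize v : ℝ))⁻¹ +
      (if H.Reachable a v then m - (√(H.compSize a : ℝ))⁻¹ else 0) +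
      (if H.Reachable b v then m - (√(H.compSize b : ℝ))⁻¹ else 0) := by
    intro v
    by_cases ha : H.Reachable a v
    · have hb : ¬ H.Reachable b v := fun h => hab (ha.trans h.symm)
      rw [compSize_sup_edge_of_reachable hab (Or.inl ha), ← compSize_congr ha]
      simp only [ha, hb, if_true, if_false, hm]
      push_cast
      ring
    · by_cases hb : H.Reachable b v
      · rw [compSize_sup_edge_of_reachable hab (Or.inr hb), ← compSize_congr hb]
        simp only [ha, hb, if_true, if_false, hm]
        push_cast
        ring
      · rw [compSize_sup_edge_of_not_reachable hne ha hb]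
        simp [ha, hb]
  have hcard : ∀ (c : V) (r : ℝ), ∑ v, (if H.Reachable c v then r else 0) = H.compSize c * r := by
    intro c r
    rw [← Finset.sum_filter, Finset.sum_const, nsmul_eq_mul]
    congr 2
    rw [compSize, Set.ncard_eq_toFinset_card']
    congr 1
    ext; simp
  have hsq : ∀ r : ℝ, 0 < r → r * (√r)⁻¹ = √r := by
    intro r hr
    rw [← div_eq_mul_inv, Real.div_sqrt]
  have pa : (0 : ℝ) < H.compSize a := by exact_mod_cast compSize_pos H a
  have pb : (0 : ℝ) < H.compSize b := by exact_mod_cast compSize_pos H b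
  unfold sqrtSum
  simp_rw [hpt, Finset.sum_add_distrib, hcard]
  have e1 := hsq _ pa
  have e2 := hsq _ pb
  have e3 := hsq _ (add_pos pa pb)
  rw [← hm] at e3
  linarith

end Sums

/-! ### Positions along the paths of a forest -/

section Positions

variable {V : Type*}

theorem IsAcyclic.exists_ndeg_le_one [Finite V] {F : SimpleGraph V} (hF : F.IsAcyclic)
    (c : F.ConnectedComponent) : ∃ v, F.connectedComponentMk v = c ∧ F.ndeg v ≤ 1 := by
  classical
  have : Fintype V := Fintype.ofFinite V
  have htree := hF.isTree_connectedComponent c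
  have hsub : ∀ v : c.supp, F.neighborSet v = (↑) '' (c.toSimpleGraph.neighborSet v) := by
    rintro ⟨v, hv⟩
    ext y
    simp only [mem_neighborSet, Set.mem_image, Subtype.exists, exists_and_right, exists_eq_right]
    constructor
    · intro h
      have hy : y ∈ c.supp := (c.mem_supp_congr_adj h).1 hv
      exact ⟨hy, (c.toSimpleGraph_adj hv hy).2 h⟩
    · rintro ⟨hy, h⟩
      exact (c.toSimpleGraph_adj hv hy).1 h
  obtain ⟨v, hv⟩ : ∃ v : c.supp, (c.toSimpleGraph.neighborSet v).ncard ≤ 1 := by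
    rcases subsingleton_or_nontrivial c.supp with h | h
    · obtain ⟨v, hv⟩ := c.nonempty_supp
      refine ⟨⟨v, hv⟩, ?_⟩
      exact Set.ncard_le_one_of_subsingleton _
    · obtain ⟨v, hv⟩ := htree.exists_vert_degree_one_of_nontrivial
      refine ⟨v, ?_⟩
      rw [Set.ncard_eq_toFinset_card', Set.toFinset_card, card_neighborSet_eq_degree, hv]
  refine ⟨v, v.2, ?_⟩
  rw [ndeg, hsub]
  exact (Set.ncard_image_le (Set.toFinite _)).trans hv

/-- A choice of an end vertex in every connected component. -/
def IsRoot (F : SimpleGraph V) (r : F.ConnectedComponent → V) : Prop :=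
  ∀ c, F.connectedComponentMk (r c) = c ∧ F.ndeg (r c) ≤ 1

/-- The position of a vertex in its component, counted from the chosen end vertex. -/
noncomputable def pos {F : SimpleGraph V} (r : F.ConnectedComponent → V) (v : V) : ℕ :=
  F.dist (r (F.connectedComponentMk v)) v

variable {G F : SimpleGraph V} {r : F.ConnectedComponent → V}

theorem mk_eq_of_adj {u v : V} (h : F.Adj u v) :
    F.connectedComponentMk u = F.connectedComponentMk v :=
  ConnectedComponent.sound h.reachable

theorem IsRoot.reachable (hr : IsRoot F r) (v : V) :
    F.Reachable (r (F.connectedComponentMk v)) v :=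
  ConnectedComponent.exact (hr _).1

theorem pos_adj (hF : F.IsAcyclic) (hr : IsRoot F r) {u v : V} (h : F.Adj u v) :
    pos r u = pos r v + 1 ∨ pos r v = pos r u + 1 := by
  unfold pos
  rw [← mk_eq_of_adj h]
  exact hF.dist_eq_dist_add_one_of_adj_of_reachable _ h (hr.reachable u)

theorem exists_adj_pos (hF : F.IsAcyclic) (hr : IsRoot F r) {v : V} {m : ℕ}
    (h : pos r v = m + 1) : ∃ u, F.Adj u v ∧ pos r u = m := by
  have key : ∀ (a : V) (p : F.Walk v a), p.length = m + 1 →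
      ∃ u, F.Adj u v ∧ ∃ q : F.Walk u a, q.length = m := by
    intro a p hp
    cases p with
    | nil => simp at hp
    | cons hadj p => exact ⟨_, hadj.symm, p, by simpa using hp⟩
  obtain ⟨p, hp⟩ := (hr.reachable v).symm.exists_walk_length_eq_dist
  rw [dist_comm] at hp
  obtain ⟨u, huv, q, hq⟩ := key _ p (hp.trans h)
  refine ⟨u, huv, ?_⟩
  have h1 := dist_le q.reverse
  rw [Walk.length_reverse, hq, ← mk_eq_of_adj huv] at h1
  change pos r u ≤ _ at h1
  have := pos_adj hF hr huv
  omega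

theorem eq_root_of_pos_eq_zero (hr : IsRoot F r) {v : V} (h : pos r v = 0) :
    v = r (F.connectedComponentMk v) :=
  ((hr.reachable v).dist_eq_zero_iff.1 h).symm

theorem pos_root (hr : IsRoot F r) (c : F.ConnectedComponent) : pos r (r c) = 0 := by
  unfold pos; rw [(hr c).1]; exact dist_self

/-- By induction two vertices at the same positive position have the same predecessor. It would have
degree two at the root, or degree three elsewhere. -/
theorem pos_inj [Finite V] (hF : IsPathForest G F) (hr : IsRoot F r) {u v : V}
    (huv : F.connectedComponentMk u = F.connectedComponentMk v) (h : pos r u = pos r v) :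
    u = v := by
  suffices H : ∀ m u v, F.connectedComponentMk u = F.connectedComponentMk v →
      pos r u = m → pos r v = m → u = v from H _ u v huv h rfl
  clear huv h u v
  intro m
  induction m with
  | zero =>
    intro u v huv hu hv
    rw [eq_root_of_pos_eq_zero hr hu, eq_root_of_pos_eq_zero hr hv, huv]
  | succ m ih =>
    intro u v huv hu hv
    obtain ⟨p, hpu, hpm⟩ := exists_adj_pos hF.acyclic hr hu
    obtain ⟨q, hqv, hqm⟩ := exists_adj_pos hF.acyclic hr hv
    have hpq : p = q := ih p q (by rw [mk_eq_of_adj hpu, mk_eq_of_adj hqv, huv]) hpm hqm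
    subst hpq
    by_contra hne
    cases m with
    | zero =>
      have h1 : ({u, v} : Set V) ⊆ F.neighborSet p := by
        rintro x (rfl | rfl) <;> simpa
      have h2 := Set.ncard_le_ncard h1 (Set.toFinite _)
      rw [Set.ncard_pair hne] at h2
      have h3 := (hr (F.connectedComponentMk p)).2
      rw [← eq_root_of_pos_eq_zero hr hpm] at h3
      unfold ndeg at h3
      omega
    | succ m =>
      obtain ⟨q, hqp, hq⟩ := exists_adj_pos hF.acyclic hr hpm
      have hqu : q ≠ u := by rintro rfl; omega
      have hqv : q ≠ v := by rintro rfl; omega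
      have h1 : ({q, u, v} : Set V) ⊆ F.neighborSet p := by
        rintro x (rfl | rfl | rfl)
        · exact hqp.symm
        · exact hpu
        · assumption
      have h2 := Set.ncard_le_ncard h1 (Set.toFinite _)
      rw [Set.ncard_eq_three.2 ⟨q, u, v, hqu, hqv, hne, rfl⟩] at h2
      have h3 := hF.ndeg_le p
      unfold ndeg at h3
      omega

theorem exists_pos_eq_of_le (hF : F.IsAcyclic) (hr : IsRoot F r) {v : V} {j : ℕ}
    (hj : j ≤ pos r v) : ∃ u, F.Reachable v u ∧ pos r u = j := by
  obtain ⟨d, hd⟩ := Nat.exists_eq_add_of_le hj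
  induction d generalizing v with
  | zero => exact ⟨v, Reachable.refl v, by omega⟩
  | succ d ih =>
    obtain ⟨u, huv, hu⟩ := exists_adj_pos hF hr (m := j + d) (by omega)
    obtain ⟨x, hx, hxj⟩ := ih (v := u) (by omega) hu
    exact ⟨x, huv.symm.reachable.trans hx, hxj⟩

theorem pos_lt_compSize [Finite V] (hF : F.IsAcyclic) (hr : IsRoot F r) (v : V) :
    pos r v < F.compSize v := by
  have h : Set.Iic (pos r v) ⊆ pos r '' {x | F.Reachable v x} := by
    intro j hj
    obtain ⟨u, hu, huj⟩ := exists_pos_eq_of_le hF hr hj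
    exact ⟨u, hu, huj⟩
  have h1 := Set.ncard_le_ncard h (Set.toFinite _)
  have h2 := Set.ncard_image_le (f := pos r) (Set.toFinite {x | F.Reachable v x})
  rw [Set.ncard_eq_toFinset_card', Set.toFinset_Iic, Nat.card_Iic] at h1
  exact lt_of_lt_of_le (Nat.lt_succ_self _) (h1.trans h2)

theorem exists_pos_eq [Finite V] (hF : IsPathForest G F) (hr : IsRoot F r) {v : V} {j : ℕ}
    (hj : j < F.compSize v) : ∃ u, F.Reachable v u ∧ pos r u = j := by
  obtain ⟨u, hu, hmax⟩ := Set.exists_max_image {x | F.Reachable v x} (pos r) (Set.toFinite _)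
    ⟨v, Reachable.refl v⟩
  have h1 : pos r '' {x | F.Reachable v x} ⊆ Set.Iic (pos r u) := by
    rintro _ ⟨x, hx, rfl⟩
    exact hmax x hx
  have h2 := Set.ncard_le_ncard h1 (Set.finite_Iic _)
  rw [Set.InjOn.ncard_image, Set.ncard_eq_toFinset_card' (Set.Iic _), Set.toFinset_Iic,
    Nat.card_Iic] at h2
  · obtain ⟨x, hx, hxj⟩ := exists_pos_eq_of_le hF.acyclic hr (v := u) (j := j)
      (by unfold compSize at hj; omega)
    exact ⟨x, Reachable.trans hu hx, hxj⟩
  · intro x hx y hy hxy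
    exact pos_inj hF hr (ConnectedComponent.sound (Reachable.trans (Reachable.symm hx) hy)) hxy

theorem exists_adj_pos_succ [Finite V] (hF : IsPathForest G F) (hr : IsRoot F r) {v : V}
    (h : pos r v + 1 < F.compSize v) : ∃ u, F.Adj v u ∧ pos r u = pos r v + 1 := by
  obtain ⟨u, hu, huj⟩ := exists_pos_eq hF hr h
  obtain ⟨p, hp, hpj⟩ := exists_adj_pos hF.acyclic hr huj
  have : p = v := pos_inj hF hr
    (ConnectedComponent.sound (hp.reachable.trans hu.symm)) hpj
  subst this
  exact ⟨u, hp, huj⟩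

theorem IsPathForest.isLinearForest [Finite V] (hF : IsPathForest G F) : F.IsLinearForest := by
  choose r hr using fun c => hF.acyclic.exists_ndeg_le_one c
  have hr : IsRoot F r := hr
  intro c
  obtain ⟨v, hv⟩ := c.nonempty_supp
  have hreach : ∀ x : c.supp, F.Reachable v x := fun x =>
    ConnectedComponent.exact ((ConnectedComponent.mem_supp_iff _ _).1 hv |>.trans
      ((ConnectedComponent.mem_supp_iff _ _).1 x.2).symm)
  refine ⟨F.compSize v, ⟨?_⟩⟩
  let f : c.supp → Fin (F.compSize v) := fun x =>
    ⟨pos r x, by rw [compSize_congr (hreach x)]; exact pos_lt_compSize hF.acyclic hr _⟩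
  have hinj : Function.Injective f := by
    intro x y hxy
    have : pos r x = pos r y := by simpa [f] using hxy
    exact Subtype.ext (pos_inj hF hr
      (ConnectedComponent.sound ((hreach x).symm.trans (hreach y))) this)
  have hsurj : Function.Surjective f := by
    rintro ⟨j, hj⟩
    obtain ⟨u, hu, huj⟩ := exists_pos_eq hF hr hj
    refine ⟨⟨u, ?_⟩, by simp [f, huj]⟩
    rw [ConnectedComponent.mem_supp_iff] at hv ⊢
    rw [← hv]
    exact ConnectedComponent.sound hu.symm
  refine ⟨Equiv.ofBijective f ⟨hinj, hsurj⟩, ?_⟩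
  rintro ⟨x, hx⟩ ⟨y, hy⟩
  rw [c.toSimpleGraph_adj hx hy]
  change (pathGraph _).Adj (f ⟨x, hx⟩) (f ⟨y, hy⟩) ↔ F.Adj x y
  simp only [pathGraph_adj, f]
  constructor
  · rintro (h | h)
    · obtain ⟨p, hp, hpj⟩ := exists_adj_pos hF.acyclic hr h.symm
      have : p = x := pos_inj hF hr
        (ConnectedComponent.sound (hp.reachable.trans ((hreach ⟨y, hy⟩).symm.trans
          (hreach ⟨x, hx⟩)))) hpj
      exact this ▸ hp
    · obtain ⟨p, hp, hpj⟩ := exists_adj_pos hF.acyclic hr h.symm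
      have : p = y := pos_inj hF hr
        (ConnectedComponent.sound (hp.reachable.trans ((hreach ⟨x, hx⟩).symm.trans
          (hreach ⟨y, hy⟩)))) hpj
      exact (this ▸ hp).symm
  · intro h
    have := pos_adj hF.acyclic hr h
    omega

/-- A vertex is `h`-shallow if it is one of the first or the last `h` vertices of its component. -/
def Shallow (r : F.ConnectedComponent → V) (h : ℕ) (v : V) : Prop :=
  pos r v < h ∨ F.compSize v ≤ pos r v + h

theorem Shallow.mono {h h' : ℕ} (hh : h ≤ h') {v : V} (hv : Shallow r h v) : Shallow r h' v := by
  unfold Shallow at *; omega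

theorem Shallow.of_adj (hF : F.IsAcyclic) (hr : IsRoot F r) {h : ℕ} {u v : V} (huv : F.Adj u v)
    (hu : Shallow r h u) : Shallow r (h + 1) v := by
  have := pos_adj hF hr huv
  have := compSize_congr huv.reachable
  unfold Shallow at *
  omega

theorem ncard_shallow_le [Finite V] (hF : IsPathForest G F) (hr : IsRoot F r) (h : ℕ)
    (c : F.ConnectedComponent) :
    {v | F.connectedComponentMk v = c ∧ Shallow r h v}.ncard ≤ 2 * h := by
  obtain ⟨x, hx⟩ := c.nonempty_supp
  rw [ConnectedComponent.mem_supp_iff] at hx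
  have h1 : pos r '' {v | F.connectedComponentMk v = c ∧ Shallow r h v} ⊆
      Set.Iio h ∪ Set.Ico (F.compSize x - h) (F.compSize x - h + h) := by
    rintro _ ⟨v, ⟨hv, hs⟩, rfl⟩
    have h2 : F.compSize v = F.compSize x :=
      compSize_congr (ConnectedComponent.exact (hv.trans hx.symm))
    have h3 := pos_lt_compSize hF.acyclic hr v
    unfold Shallow at hs
    simp only [Set.mem_union, Set.mem_Iio, Set.mem_Ico]
    omega
  rw [← Set.InjOn.ncard_image (f := pos r)]
  · refine (Set.ncard_le_ncard h1 (Set.toFinite _)).trans ((Set.ncard_union_le _ _).trans ?_)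
    rw [Set.ncard_eq_toFinset_card' (Set.Iio h), Set.ncard_eq_toFinset_card' (Set.Ico _ _)]
    simp only [Set.toFinset_Iio, Nat.Iio_eq_range, Finset.card_range, Set.toFinset_Ico,
      Nat.card_Ico]
    omega
  · rintro u ⟨hu, _⟩ v ⟨hv, _⟩ huv
    exact pos_inj hF hr (hu.trans hv.symm) huv

end Positions

/-! ### Rotations -/

section Rotation

variable {V : Type*}

/-- The rotation that replaces the edge `yw` by the edge `zy`. -/
def rotate (F : SimpleGraph V) (z y w : V) : SimpleGraph V := F.deleteEdges {s(y, w)} ⊔ edge z y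

theorem rotate_adj_iff {F : SimpleGraph V} {z y w v : V} (hz : v ≠ z) (hy : v ≠ y) (hw : v ≠ w)
    (x : V) : (F.rotate z y w).Adj v x ↔ F.Adj v x := by
  simp only [rotate, sup_adj, deleteEdges_adj, Set.mem_singleton_iff, Sym2.eq_iff, edge_adj]
  grind

theorem rotate_adj_of_adj {F : SimpleGraph V} {z y w a b : V} (h : F.Adj a b)
    (hne : s(a, b) ≠ s(y, w)) : (F.rotate z y w).Adj a b := by
  rw [rotate, sup_adj, deleteEdges_adj]
  exact Or.inl ⟨h, hne⟩

theorem ndeg_congr {F F' : SimpleGraph V} {v : V} (h : ∀ x, F'.Adj v x ↔ F.Adj v x) :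
    F'.ndeg v = F.ndeg v := by
  unfold ndeg
  congr 1
  ext x
  exact h x

/-- `w` follows `y` on a path to `z`, whose remainder avoids `y`. -/
theorem exists_adj_reachable_deleteEdges {F : SimpleGraph V} {y z : V}
    (hne : y ≠ z) (h : F.Reachable y z) :
    ∃ w, F.Adj y w ∧ (F.deleteEdges {s(y, w)}).Reachable z w := by
  obtain ⟨p, hp⟩ := h.exists_isPath
  cases p with
  | nil => exact absurd rfl hne
  | @cons _ w _ hadj p =>
    rw [Walk.cons_isPath_iff] at hp
    refine ⟨w, hadj, Reachable.symm ⟨p.transfer _ ?_⟩⟩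
    intro e he
    rw [edgeSet_deleteEdges]
    refine ⟨p.edges_subset_edgeSet he, ?_⟩
    rintro rfl
    exact hp.2 (p.fst_mem_support_of_mem_edges he)

/-- The branch at `y` through `w₂` never returns to `y`, so cutting `yw₁` leaves it attached to `y`.
-/
theorem reachable_deleteEdges_of_ne {F : SimpleGraph V} (hF : F.IsAcyclic) {y w₁ w₂ x : V}
    (hne : w₁ ≠ w₂) (h₂ : F.Adj y w₂) (hx : (F.deleteEdges {s(y, w₂)}).Reachable w₂ x) :
    (F.deleteEdges {s(y, w₁)}).Reachable y x := by
  have hnr := hF.not_reachable_deleteEdges h₂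
  have key : ∀ (u : V) (_ : (F.deleteEdges {s(y, w₂)}).Walk u x),
      (F.deleteEdges {s(y, w₂)}).Reachable w₂ u → (F.deleteEdges {s(y, w₁)}).Reachable y u →
      (F.deleteEdges {s(y, w₁)}).Reachable y x := by
    intro u p
    induction p with
    | nil => intro _ h; exact h
    | @cons u v _ hadj p ih =>
      intro hu hyu
      have hv := hu.trans hadj.reachable
      refine ih hx hv (hyu.trans (Adj.reachable ?_))
      rw [deleteEdges_adj] at hadj ⊢
      refine ⟨hadj.1, ?_⟩
      rw [Set.mem_singleton_iff, Sym2.eq_iff]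
      rintro (⟨rfl, rfl⟩ | ⟨rfl, rfl⟩)
      · exact hnr hu.symm
      · exact hnr hv.symm
  obtain ⟨p⟩ := hx
  refine key w₂ p (Reachable.refl _) (Adj.reachable ?_)
  rw [deleteEdges_adj]
  refine ⟨h₂, ?_⟩
  rw [Set.mem_singleton_iff, Sym2.eq_iff]
  rintro (⟨_, h⟩ | ⟨h, h'⟩)
  · exact hne h.symm
  · exact h₂.ne h'.symm

variable [Finite V] {G F : SimpleGraph V} {z y w : V}

theorem IsPathForest.sup_edge (hF : IsPathForest G F) {u v : V} (hu : F.ndeg u ≤ 1)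
    (hv : F.ndeg v ≤ 1) (huv : G.Adj u v) (hr : ¬ F.Reachable u v) :
    IsPathForest G (F ⊔ edge u v) := by
  classical
  refine ⟨sup_le hF.le ?_, hF.acyclic.sup_edge_of_not_reachable hr, fun x => ?_⟩
  · rwa [edge_le_iff, or_iff_right huv.ne]
  · rw [ndeg_sup_edge (fun h => hr h.reachable) huv.ne]
    have := hF.ndeg_le x
    have hne := huv.ne
    by_cases h1 : x = u
    · subst h1; simp [hne]; omega
    · by_cases h2 : x = v
      · subst h2; simp [h1]; omega
      · simp [h1, h2, this]

theorem IsPathForest.rotate (hF : IsPathForest G F) (hz : F.ndeg z ≤ 1) (hzy : G.Adj z y)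
    (hn : ¬ F.Adj z y) (hyw : F.Adj y w)
    (hr : ¬ (F.deleteEdges {s(y, w)}).Reachable z y) : IsPathForest G (F.rotate z y w) := by
  classical
  have hne := hzy.ne
  have hzw : z ≠ w := by rintro rfl; exact hn hyw.symm
  have hH : IsPathForest G (F.deleteEdges {s(y, w)}) := by
    refine ⟨(deleteEdges_le _).trans hF.le, hF.acyclic.anti (deleteEdges_le _), fun x => ?_⟩
    refine le_trans (Set.ncard_le_ncard ?_ (Set.toFinite _)) (hF.ndeg_le x)
    exact neighborSet_mono (deleteEdges_le _) x
  have hdeg := ndeg_sup_edge (H := F.deleteEdges {s(y, w)}) (a := y) (b := w)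
    (fun h => hF.acyclic.not_reachable_deleteEdges hyw h.reachable) hyw.ne
  rw [sup_edge_deleteEdges hyw] at hdeg
  apply hH.sup_edge _ _ hzy hr
  · have := hdeg z
    simp [hne, hzw] at this
    omega
  · have h1 := hdeg y
    have h2 := hF.ndeg_le y
    simp [hyw.ne] at h1
    omega

theorem ndeg_rotate_right (hF : F.IsAcyclic) (hn : ¬ F.Adj z y) (hyw : F.Adj y w) :
    (F.rotate z y w).ndeg w + 1 = F.ndeg w := by
  classical
  have hzw : z ≠ w := by rintro rfl; exact hn hyw.symm
  have hdeg := ndeg_sup_edge (H := F.deleteEdges {s(y, w)}) (a := y) (b := w)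
    (fun h => hF.not_reachable_deleteEdges hyw h.reachable) hyw.ne w
  rw [sup_edge_deleteEdges hyw] at hdeg
  have : (F.rotate z y w).ndeg w = (F.deleteEdges {s(y, w)}).ndeg w := by
    apply ndeg_congr
    intro x
    have := hyw.ne
    simp only [SimpleGraph.rotate, sup_adj, edge_adj]
    grind
  rw [this, hdeg]
  simp [hyw.ne.symm]

theorem ndeg_rotate_mid (hF : F.IsAcyclic) (hzy : z ≠ y) (hyw : F.Adj y w)
    (hr : ¬ (F.deleteEdges {s(y, w)}).Reachable z y) :
    (F.rotate z y w).ndeg y = F.ndeg y := by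
  classical
  have hdeg := ndeg_sup_edge (H := F.deleteEdges {s(y, w)}) (a := y) (b := w)
    (fun h => hF.not_reachable_deleteEdges hyw h.reachable) hyw.ne y
  rw [sup_edge_deleteEdges hyw] at hdeg
  rw [hdeg, SimpleGraph.rotate, ndeg_sup_edge (fun h => hr h.reachable) hzy]
  simp [hyw.ne, hzy.symm]

end Rotation

/-! ### Optimal forests and the size control of a rotation -/

section Optimal

variable {V : Type*} [Fintype V] {G F F' : SimpleGraph V} {z y w : V}

theorem degSum_rotate (hF : F.IsAcyclic) (hzy : z ≠ y) (hyw : F.Adj y w)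
    (hr : ¬ (F.deleteEdges {s(y, w)}).Reachable z y) : (F.rotate z y w).degSum = F.degSum := by
  have h1 := degSum_sup_edge (H := F.deleteEdges {s(y, w)}) (a := y) (b := w)
    (fun h => hF.not_reachable_deleteEdges hyw h.reachable) hyw.ne
  rw [sup_edge_deleteEdges hyw] at h1
  rw [rotate, h1, degSum_sup_edge (fun h => hr h.reachable) hzy]

/-- The change of the sum of the square roots of the component sizes under a rotation. -/
theorem sqrtSum_rotate (hF : F.IsAcyclic) (hyw : F.Adj y w)
    (hr : ¬ (F.deleteEdges {s(y, w)}).Reachable z y) {a b q : ℝ}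
    (ha : ((F.deleteEdges {s(y, w)}).compSize w : ℝ) = a)
    (hb : ((F.deleteEdges {s(y, w)}).compSize y : ℝ) = b)
    (hq : ((F.deleteEdges {s(y, w)}).compSize z : ℝ) = q) :
    (F.rotate z y w).sqrtSum = F.sqrtSum + √a + √(q + b) - √q - √(b + a) := by
  have h1 := sqrtSum_sup_edge (hF.not_reachable_deleteEdges hyw)
  rw [sup_edge_deleteEdges hyw, ha, hb] at h1
  rw [rotate, sqrtSum_sup_edge hr, hb, hq, h1]
  ring

/-- A path forest with as many edges as possible and, subject to this, with the largest possible
sum of the square roots of the sizes of its components. -/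
structure IsOptimal (G F : SimpleGraph V) : Prop where
  isPathForest : IsPathForest G F
  degSum_le : ∀ F', IsPathForest G F' → F'.degSum ≤ F.degSum
  sqrtSum_le : ∀ F', IsPathForest G F' → F'.degSum = F.degSum → F'.sqrtSum ≤ F.sqrtSum

theorem exists_isOptimal (G : SimpleGraph V) : ∃ F, IsOptimal G F := by
  have hbot : IsPathForest G ⊥ := ⟨bot_le, isAcyclic_bot, fun v => by simp [ndeg]⟩
  obtain ⟨F₁, h₁, hmax₁⟩ := Set.exists_max_image {F | IsPathForest G F} degSum
    (Set.toFinite _) ⟨⊥, hbot⟩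
  obtain ⟨F₂, h₂, hmax₂⟩ := Set.exists_max_image
    {F | IsPathForest G F ∧ F.degSum = F₁.degSum} sqrtSum (Set.toFinite _) ⟨F₁, h₁, rfl⟩
  exact ⟨F₂, h₂.1, fun F' h => h₂.2 ▸ hmax₁ F' h, fun F' h h' => hmax₂ F' ⟨h, h'.trans h₂.2⟩⟩

theorem IsOptimal.not_adj (hF : IsOptimal G F) (hF' : IsPathForest G F')
    (hdeg : F'.degSum = F.degSum) {u v : V} (hu : F'.ndeg u ≤ 1) (hv : F'.ndeg v ≤ 1)
    (hr : ¬ F'.Reachable u v) : ¬ G.Adj u v := by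
  intro h
  have h1 := hF.degSum_le _ (hF'.sup_edge hu hv h hr)
  rw [degSum_sup_edge (fun h => hr h.reachable) h.ne] at h1
  omega

/-- Splitting a path into two long pieces gains 3√m: √m for the cost of absorbing a short path, and
more than √m beyond the allowed deficit. -/
theorem add_sqrt_sub_sqrt_add_le {a b m : ℝ} (hm : 0 ≤ m) (ha : 100 * m ≤ a)
    (hb : 100 * m ≤ b) : √(b + a) + 3 * √m ≤ √a + √b := by
  have hm2 := Real.sq_sqrt hm
  have ha2 := Real.sq_sqrt (show 0 ≤ a by linarith)
  have hb2 := Real.sq_sqrt (show 0 ≤ b by linarith)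
  have hm0 := Real.sqrt_nonneg m
  have ha3 : 10 * √m ≤ √a := Real.le_sqrt_of_sq_le (by nlinarith)
  have hb3 : 10 * √m ≤ √b := Real.le_sqrt_of_sq_le (by nlinarith)
  have : √(b + a) ≤ √a + √b - 3 * √m := by
    rw [Real.sqrt_le_left (by linarith)]
    nlinarith [mul_le_mul_of_nonneg_right ha3 (Real.sqrt_nonneg b),
      mul_le_mul_of_nonneg_right hb3 (Real.sqrt_nonneg a)]
  linarith

theorem sqrt_add_le (a b : ℝ) (ha : 0 ≤ a) (hb : 0 ≤ b) : √(b + a) ≤ √a + √b := by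
  rw [Real.sqrt_le_left (by positivity)]
  nlinarith [Real.sq_sqrt ha, Real.sq_sqrt hb, Real.sqrt_nonneg a, Real.sqrt_nonneg b,
    mul_nonneg (Real.sqrt_nonneg a) (Real.sqrt_nonneg b)]

/-- Rotation at a neighbour `y` of an end vertex `z` in a small component, controlling the size of
the component of the new end vertex. -/
theorem IsOptimal.exists_rotate (hF : IsOptimal G F) (hF' : IsPathForest G F')
    (hdeg : F'.degSum = F.degSum) {l : ℕ} (hsq : F.sqrtSum - √l ≤ F'.sqrtSum)
    (hz : F'.ndeg z ≤ 1) (hzl : F'.compSize z ≤ l) (hzy : G.Adj z y) (hn : ¬ F'.Adj z y) :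
    ∃ w, F'.Adj y w ∧ IsPathForest G (F'.rotate z y w) ∧ (F'.rotate z y w).degSum = F.degSum ∧
      F.sqrtSum - √(100 * l : ℕ) ≤ (F'.rotate z y w).sqrtSum ∧ (F'.rotate z y w).ndeg w ≤ 1 ∧
      (F'.rotate z y w).compSize w ≤ 100 * l := by
  have hac := hF'.acyclic
  have hs100 : √((100 * l : ℕ) : ℝ) = 10 * √l := by
    push_cast
    rw [Real.sqrt_mul (by norm_num)]
    congr 1
    rw [show (100 : ℝ) = 10 ^ 2 by norm_num, Real.sqrt_sq (by norm_num)]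
  have hndeg : ∀ w, F'.Adj y w → (F'.rotate z y w).ndeg w ≤ 1 := by
    intro w hyw
    have := ndeg_rotate_right hac hn hyw
    have := hF'.ndeg_le w
    omega
  -- If `y` lies on the path of `z`, cutting at the neighbour of `y` towards `z` keeps the vertex
  -- set of the path, hence all component sizes.
  by_cases hreach : F'.Reachable y z
  · obtain ⟨w, hyw, hw⟩ := exists_adj_reachable_deleteEdges hzy.ne.symm hreach
    have hnr : ¬ (F'.deleteEdges {s(y, w)}).Reachable z y := fun h =>
      hac.not_reachable_deleteEdges hyw (h.symm.trans hw)
    refine ⟨w, hyw, hF'.rotate hz hzy hn hyw hnr, (degSum_rotate hac hzy.ne hyw hnr).trans hdeg,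
      ?_, hndeg w hyw, ?_⟩
    · rw [sqrtSum_rotate hac hyw hnr rfl rfl rfl, compSize_congr hw,
        add_comm ((F'.deleteEdges {s(y, w)}).compSize y : ℝ), hs100]
      have := Real.sqrt_nonneg l
      linarith
    · rw [rotate, compSize_sup_edge_of_reachable hnr (Or.inl hw)]
      have h1 := compSize_sup_edge_of_reachable (hac.not_reachable_deleteEdges hyw)
        (Or.inr hw.symm)
      rw [sup_edge_deleteEdges hyw] at h1
      rw [compSize_congr hw]
      omega
  · have hnr : ∀ w, ¬ (F'.deleteEdges {s(y, w)}).Reachable z y := fun w h =>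
      hreach (h.mono (deleteEdges_le _)).symm
    have hq : ∀ w, F'.Adj y w → (F'.deleteEdges {s(y, w)}).compSize z = F'.compSize z := by
      intro w hyw
      have h1 := compSize_sup_edge_of_not_reachable (H := F'.deleteEdges {s(y, w)}) (x := z)
        hyw.ne (fun h => hnr w h.symm)
        (fun h => hreach (hyw.reachable.trans (h.mono (deleteEdges_le _))))
      rw [sup_edge_deleteEdges hyw] at h1
      exact h1.symm
    have hgood : ∀ w, F'.Adj y w → (F'.deleteEdges {s(y, w)}).compSize w ≤ 100 * l →
        F'.Adj y w ∧ IsPathForest G (F'.rotate z y w) ∧ (F'.rotate z y w).degSum = F.degSum ∧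
        F.sqrtSum - √(100 * l : ℕ) ≤ (F'.rotate z y w).sqrtSum ∧ (F'.rotate z y w).ndeg w ≤ 1 ∧
        (F'.rotate z y w).compSize w ≤ 100 * l := by
      intro w hyw hw
      refine ⟨hyw, hF'.rotate hz hzy hn hyw (hnr w),
        (degSum_rotate hac hzy.ne hyw (hnr w)).trans hdeg, ?_, hndeg w hyw, ?_⟩
      · rw [sqrtSum_rotate hac hyw (hnr w) rfl rfl rfl, hs100, hq w hyw]
        set a : ℝ := ((F'.deleteEdges {s(y, w)}).compSize w : ℝ) with ha
        set b : ℝ := ((F'.deleteEdges {s(y, w)}).compSize y : ℝ) with hb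
        have h1 := sqrt_add_le a b (by positivity) (by positivity)
        have h2 : √b ≤ √((F'.compSize z : ℝ) + b) :=
          Real.sqrt_le_sqrt (le_add_of_nonneg_left (by positivity))
        have h3 : √(F'.compSize z : ℝ) ≤ √l := Real.sqrt_le_sqrt (by exact_mod_cast hzl)
        have := Real.sqrt_nonneg l
        linarith
      · rw [rotate, compSize_sup_edge_of_not_reachable hzy.ne _
          (hac.not_reachable_deleteEdges hyw)]
        · exact hw
        · intro h
          exact hreach (hyw.reachable.trans (h.mono (deleteEdges_le _)).symm)
    have hy2 : 2 ≤ F'.ndeg y := by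
      by_contra h
      exact hF.not_adj hF' hdeg hz (by omega) (fun h => hreach h.symm) hzy
    obtain ⟨w₁, hw₁, w₂, hw₂, hne⟩ := (Set.one_lt_ncard (Set.toFinite _)).1
      (show 1 < (F'.neighborSet y).ncard from hy2)
    have hw₁ : F'.Adj y w₁ := hw₁
    have hw₂ : F'.Adj y w₂ := hw₂
    by_cases h1 : (F'.deleteEdges {s(y, w₁)}).compSize w₁ ≤ 100 * l
    · exact ⟨w₁, hgood w₁ hw₁ h1⟩
    -- Cutting `yw₂` instead leaves at `w₂` a piece contained in the component of `y` after cutting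
    -- `yw₁`.
    by_cases h2 : (F'.deleteEdges {s(y, w₁)}).compSize y ≤ 100 * l
    · refine ⟨w₂, hgood w₂ hw₂ (le_trans (Set.ncard_le_ncard ?_ (Set.toFinite _)) h2)⟩
      intro x hx
      exact reachable_deleteEdges_of_ne hac hne hw₂ hx
    -- Both pieces exceed 100l, so the rotation gains at least 3√l - √l = 2√l, more than the deficit
    -- √l of `F'`.
    exfalso
    have h3 := hF.sqrtSum_le _ (hF'.rotate hz hzy hn hw₁ (hnr w₁))
      ((degSum_rotate hac hzy.ne hw₁ (hnr w₁)).trans hdeg)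
    rw [sqrtSum_rotate hac hw₁ (hnr w₁) rfl rfl rfl, hq w₁ hw₁] at h3
    push Not at h1 h2
    set a : ℝ := ((F'.deleteEdges {s(y, w₁)}).compSize w₁ : ℝ) with ha
    set b : ℝ := ((F'.deleteEdges {s(y, w₁)}).compSize y : ℝ) with hb
    have h4 := add_sqrt_sub_sqrt_add_le (a := a) (b := b) (m := l) (by positivity)
      (by rw [ha]; exact_mod_cast h1.le) (by rw [hb]; exact_mod_cast h2.le)
    have h5 : √b ≤ √((F'.compSize z : ℝ) + b) :=
      Real.sqrt_le_sqrt (le_add_of_nonneg_left (by positivity))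
    have h6 : √(F'.compSize z : ℝ) ≤ √l := Real.sqrt_le_sqrt (by exact_mod_cast hzl)
    have h7 : 0 < √(l : ℝ) := by
      apply Real.sqrt_pos.2
      have := compSize_pos F' z
      exact_mod_cast (show 0 < l by omega)
    linarith

end Optimal

/-! ### End vertices reachable by successive rotations -/

section Levels

variable {V : Type*} [Fintype V] {G F F' : SimpleGraph V} {A B : Set F.ConnectedComponent}
  {S T : Set V} {l m : ℕ} {w : V}

/-- `F'` is a path forest with as many edges as `F` in which `w` is an end vertex of a path with at
most `l` vertices, and which differs from `F` only inside the components in `A` and near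
`insert w S`. -/
structure IsReroute (G F : SimpleGraph V) (A : Set F.ConnectedComponent) (S : Set V) (l : ℕ)
    (w : V) (F' : SimpleGraph V) : Prop where
  isPathForest : IsPathForest G F'
  degSum_eq : F'.degSum = F.degSum
  le_sqrtSum : F.sqrtSum - √l ≤ F'.sqrtSum
  ndeg_le : F'.ndeg w ≤ 1
  compSize_le : F'.compSize w ≤ l
  adj_iff_of_mk_notMem : ∀ v, F.connectedComponentMk v ∉ A → ∀ x, F'.Adj v x ↔ F.Adj v x
  adj_iff_of_notMem : ∀ v, v ∉ insert w S → (∀ u, F.Adj v u → u ∉ insert w S) →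
    ∀ x, F'.Adj v x ↔ F.Adj v x

theorem IsReroute.mono (h : IsReroute G F A S l w F') (hA : A ⊆ B) (hS : S ⊆ T) (hl : l ≤ m) :
    IsReroute G F B T m w F' where
  isPathForest := h.isPathForest
  degSum_eq := h.degSum_eq
  le_sqrtSum := by
    have : √(l : ℝ) ≤ √(m : ℝ) := Real.sqrt_le_sqrt (by exact_mod_cast hl)
    linarith [h.le_sqrtSum]
  ndeg_le := h.ndeg_le
  compSize_le := h.compSize_le.trans hl
  adj_iff_of_mk_notMem v hv := h.adj_iff_of_mk_notMem v fun h' => hv (hA h')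
  adj_iff_of_notMem v hv hu := h.adj_iff_of_notMem v
    (fun h' => hv (Set.insert_subset_insert hS h'))
    fun u huv h' => hu u huv (Set.insert_subset_insert hS h')

/-- The vertices that become end vertices of short paths after at most `s` rotations inside the
components in `A`, starting from the chosen end vertices of the paths with at most `l` vertices. -/
def level (G : SimpleGraph V) (r : F.ConnectedComponent → V) (l : ℕ) :
    ℕ → Set F.ConnectedComponent → Set V
  | 0, A => {v | v = r (F.connectedComponentMk v) ∧ F.connectedComponentMk v ∈ A ∧
      F.compSize v ≤ l}
  | s + 1, A => level G r l s A ∪ {w | F.connectedComponentMk w ∈ A ∧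
      Shallow r (5 * (100 ^ (s + 1) * l)) w ∧
      ∃ F', IsReroute G F A (level G r l s A) (100 ^ (s + 1) * l) w F'}

variable {r : F.ConnectedComponent → V} {s t : ℕ}

theorem level_subset_level (hst : s ≤ t) : level G r l s A ⊆ level G r l t A := by
  induction hst with
  | refl => exact subset_rfl
  | step _ ih => exact ih.trans Set.subset_union_left

theorem level_mono (s : ℕ) (hAB : A ⊆ B) : level G r l s A ⊆ level G r l s B := by
  induction s with
  | zero => exact fun v hv => ⟨hv.1, hAB hv.2.1, hv.2.2⟩
  | succ s ih =>
    refine Set.union_subset_union ih ?_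
    rintro w ⟨h1, h2, F', h3⟩
    exact ⟨hAB h1, h2, F', h3.mono hAB ih le_rfl⟩

theorem mk_mem_of_mem_level (h : w ∈ level G r l s A) : F.connectedComponentMk w ∈ A := by
  induction s with
  | zero => exact h.2.1
  | succ s ih => exact h.elim ih fun h => h.1

theorem shallow_of_mem_level (hr : IsRoot F r) (h : w ∈ level G r l s A) :
    Shallow r (5 * (100 ^ s * l)) w := by
  induction s with
  | zero =>
    left
    have h1 := compSize_pos F w
    have h2 := h.2.2
    have h3 := pos_root hr (F.connectedComponentMk w)
    rw [← h.1] at h3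
    omega
  | succ s ih =>
    rcases h with h | h
    · refine (ih h).mono ?_
      gcongr <;> omega
    · exact h.2.1

theorem exists_isReroute_of_mem_level (hF : IsPathForest G F) (hr : IsRoot F r)
    (h : w ∈ level G r l s A) : ∃ F', IsReroute G F A (level G r l s A) (100 ^ s * l) w F' := by
  induction s with
  | zero =>
    refine ⟨F, hF, rfl, by linarith [Real.sqrt_nonneg ((100 ^ 0 * l : ℕ) : ℝ)], ?_, ?_,
      fun _ _ _ => Iff.rfl, fun _ _ _ _ => Iff.rfl⟩
    · rw [h.1]; exact (hr _).2
    · have := h.2.2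
      omega
  | succ s ih =>
    rcases h with h | ⟨_, _, F', h⟩
    · obtain ⟨F', hF'⟩ := ih h
      exact ⟨F', hF'.mono subset_rfl Set.subset_union_left (by gcongr <;> omega)⟩
    · exact ⟨F', h.mono subset_rfl Set.subset_union_left le_rfl⟩

theorem lt_compSize_of_forall_pos {H : SimpleGraph V} {a : ℕ}
    (h : ∀ j, a ≤ j → j ≤ a + l → ∃ u, H.Reachable w u ∧ pos r u = j) : l < H.compSize w := by
  have h1 : Set.Icc a (a + l) ⊆ pos r '' {x | H.Reachable w x} := by
    rintro j ⟨h1, h2⟩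
    exact h j h1 h2
  have h2 := Set.ncard_le_ncard h1 (Set.toFinite _)
  have h3 := Set.ncard_image_le (f := pos r) (Set.toFinite {x | H.Reachable w x})
  rw [Set.ncard_eq_toFinset_card' (Set.Icc _ _), Set.toFinset_Icc, Nat.card_Icc] at h2
  unfold compSize
  omega

/-- If the new end vertex lay deep inside a path of `F`, then a long path would end in it after the
rotation. -/
theorem shallow_of_compSize_rotate_le (hF : IsPathForest G F) (hr : IsRoot F r) {z y : V}
    {h : ℕ} (hS : ∀ x ∈ S, Shallow r h x) (hagree : ∀ v, v ∉ S → (∀ u, F.Adj v u → u ∉ S) →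
      ∀ x, F'.Adj v x ↔ F.Adj v x) (hyw : F.Adj y w) (hl : (F'.rotate z y w).compSize w ≤ l) :
    Shallow r (h + l + 1) w := by
  by_contra hw
  have hw : h + l + 1 ≤ pos r w ∧ pos r w + (h + l + 1) < F.compSize w := by
    unfold Shallow at hw
    push Not at hw
    exact hw
  have hadj : ∀ u v, F.Reachable w u → pos r u ≤ pos r w + l → pos r w ≤ pos r u + l →
      F.Adj u v → F'.Adj u v := by
    intro u v hwu h1 h2 huv
    have hcs := compSize_congr hwu
    refine (hagree u ?_ ?_ v).2 huv
    · intro hu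
      have := hS u hu
      unfold Shallow at this
      omega
    · intro x hux hx
      have := (hS x hx).of_adj hF.acyclic hr hux.symm
      unfold Shallow at this
      omega
  refine absurd hl (not_le.2 ?_)
  -- Follow the path of `F` from `w` away from `y` for `l` steps. It avoids the edge `yw` and stays
  -- where `F'` agrees with `F`; the extra 1 in the depth accounts for the neighbours of `S`.
  rcases pos_adj hF.acyclic hr hyw with hpos | hpos
  · have key : ∀ i ≤ l, ∃ u, F.Reachable w u ∧ (F'.rotate z y w).Reachable w u ∧
        pos r u + i = pos r w := by
      intro i
      induction i with
      | zero => exact fun _ => ⟨w, Reachable.refl _, Reachable.refl _, rfl⟩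
      | succ i ih =>
        intro hi
        obtain ⟨u, hu1, hu2, hu3⟩ := ih (by omega)
        obtain ⟨v, hv, hvp⟩ := exists_adj_pos hF.acyclic hr (v := u) (m := pos r u - 1) (by omega)
        refine ⟨v, hu1.trans hv.symm.reachable, hu2.trans (Adj.reachable ?_), by omega⟩
        refine rotate_adj_of_adj (hadj u v hu1 (by omega) (by omega) hv.symm) ?_
        rw [Ne, Sym2.eq_iff]
        rintro (⟨rfl, rfl⟩ | ⟨rfl, rfl⟩) <;> omega
    refine lt_compSize_of_forall_pos (r := r) (a := pos r w - l) fun j h1 h2 => ?_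
    obtain ⟨u, _, hu, hp⟩ := key (pos r w - j) (by omega)
    exact ⟨u, hu, by omega⟩
  · have key : ∀ i ≤ l, ∃ u, F.Reachable w u ∧ (F'.rotate z y w).Reachable w u ∧
        pos r u = pos r w + i := by
      intro i
      induction i with
      | zero => exact fun _ => ⟨w, Reachable.refl _, Reachable.refl _, rfl⟩
      | succ i ih =>
        intro hi
        obtain ⟨u, hu1, hu2, hu3⟩ := ih (by omega)
        have hcs := compSize_congr hu1
        obtain ⟨v, hv, hvp⟩ := exists_adj_pos_succ hF hr (v := u) (by omega)
        refine ⟨v, hu1.trans hv.reachable, hu2.trans (Adj.reachable ?_), by omega⟩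
        refine rotate_adj_of_adj (hadj u v hu1 (by omega) (by omega) hv) ?_
        rw [Ne, Sym2.eq_iff]
        rintro (⟨rfl, rfl⟩ | ⟨rfl, rfl⟩) <;> omega
    refine lt_compSize_of_forall_pos (r := r) (a := pos r w) fun j h1 h2 => ?_
    obtain ⟨u, _, hu, hp⟩ := key (j - pos r w) (by omega)
    exact ⟨u, hu, by omega⟩

/-- A neighbour of a level inside the components in `A` is, up to a neighbour in `F`, in the next
level. -/
theorem IsOptimal.exists_mem_level_succ (hF : IsOptimal G F) (hr : IsRoot F r) {z y : V}
    (hz : z ∈ level G r l s A) (hzy : G.Adj z y) (hy : F.connectedComponentMk y ∈ A) :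
    y ∈ level G r l (s + 1) A ∨ ∃ u, F.Adj u y ∧ u ∈ level G r l (s + 1) A := by
  by_contra hcon
  push Not at hcon
  obtain ⟨hy1, hy2⟩ := hcon
  have hsub : level G r l s A ⊆ level G r l (s + 1) A := Set.subset_union_left
  obtain ⟨F', hF'⟩ := exists_isReroute_of_mem_level hF.isPathForest hr hz
  have hins : insert z (level G r l s A) = level G r l s A := Set.insert_eq_of_mem hz
  have hagree := hF'.adj_iff_of_notMem
  rw [hins] at hagree
  -- `F'` agrees with `F` at `y`, so the end created by rotating there is an `F`-neighbour of `y`;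
  -- it lies in the next level, against `hy2`.
  have hyF' : ∀ x, F'.Adj y x ↔ F.Adj y x :=
    hagree y (fun h => hy1 (hsub h)) fun u hu h => hy2 u hu.symm (hsub h)
  have hn : ¬ F'.Adj z y := fun h => hy2 z ((hyF' z).1 h.symm).symm (hsub hz)
  obtain ⟨w, hyw, hpf, hdeg, hsq, hnd, hcs⟩ := hF.exists_rotate hF'.isPathForest hF'.degSum_eq
    hF'.le_sqrtSum hF'.ndeg_le hF'.compSize_le hzy hn
  have hyw := (hyF' w).1 hyw
  have hwA : F.connectedComponentMk w ∈ A := mk_eq_of_adj hyw ▸ hy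
  rw [show 100 * (100 ^ s * l) = 100 ^ (s + 1) * l by ring] at hsq hcs
  refine hy2 w hyw.symm (Or.inr ⟨hwA, ?_, F'.rotate z y w, hpf, hdeg, hsq, hnd, hcs, ?_, ?_⟩)
  · refine (shallow_of_compSize_rotate_le hF.isPathForest hr
      (fun x hx => shallow_of_mem_level hr hx) hagree hyw hcs).mono ?_
    have h1 : 0 < 100 ^ (s + 1) * l := lt_of_lt_of_le (compSize_pos _ _) hcs
    rw [pow_succ, mul_right_comm] at h1 ⊢
    omega
  · intro v hv x
    rw [rotate_adj_iff, hF'.adj_iff_of_mk_notMem v hv]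
    · rintro rfl; exact hv (mk_mem_of_mem_level hz)
    · rintro rfl; exact hv hy
    · rintro rfl; exact hv hwA
  · intro v hv hvu x
    rw [rotate_adj_iff, hagree v (fun h => hv (Set.mem_insert_of_mem _ h))
      fun u hu h => hvu u hu (Set.mem_insert_of_mem _ h)]
    · rintro rfl; exact hv (Set.mem_insert_of_mem _ hz)
    · rintro rfl; exact hvu w hyw (Set.mem_insert _ _)
    · rintro rfl; exact hv (Set.mem_insert _ _)

/-- Here `y` may lie outside `A`, so the previous lemma is used with all components allowed. This
bounds the number of neighbours of a level in each single component. -/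
theorem IsOptimal.shallow_of_adj_level (hF : IsOptimal G F) (hr : IsRoot F r) {z y : V}
    (hz : z ∈ level G r l s A) (hzy : G.Adj z y) : Shallow r (5 * (100 ^ (s + 1) * l) + 1) y := by
  rcases hF.exists_mem_level_succ hr (level_mono s (Set.subset_univ A) hz) hzy (Set.mem_univ _)
    with h | ⟨u, huy, hu⟩
  · exact (shallow_of_mem_level hr h).mono (Nat.le_succ _)
  · exact (shallow_of_mem_level hr hu).of_adj hF.isPathForest.acyclic hr huy

end Levels

/-! ### Gluing reroutings in complementary sets of components -/

section Combine

variable {V : Type*}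

theorem Walk.edges_mem_of_closed {H K : SimpleGraph V} {P : Set V}
    (h : ∀ x y, x ∈ P → H.Adj x y → y ∈ P ∧ K.Adj x y) {u v : V} (p : H.Walk u v) (hu : u ∈ P) :
    v ∈ P ∧ ∀ e ∈ p.edges, e ∈ K.edgeSet := by
  induction p with
  | nil => exact ⟨hu, by simp⟩
  | cons hadj p ih =>
    obtain ⟨h1, h2⟩ := h _ _ hu hadj
    obtain ⟨h3, h4⟩ := ih h1
    refine ⟨h3, ?_⟩
    intro e he
    rw [Walk.edges_cons, List.mem_cons] at he
    rcases he with rfl | he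
    · exact h2
    · exact h4 e he

/-- No edge leaves `P`, so a cycle lies in one side and hence in `K₁` or `K₂`. -/
theorem isAcyclic_of_closed {H K₁ K₂ : SimpleGraph V} {P : Set V} (hK₁ : K₁.IsAcyclic)
    (hK₂ : K₂.IsAcyclic) (h₁ : ∀ x y, x ∈ P → H.Adj x y → y ∈ P ∧ K₁.Adj x y)
    (h₂ : ∀ x y, x ∈ Pᶜ → H.Adj x y → y ∈ Pᶜ ∧ K₂.Adj x y) : H.IsAcyclic := by
  intro v c hc
  by_cases hv : v ∈ P
  · exact hK₁ _ (hc.transfer (c.edges_mem_of_closed h₁ hv).2)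
  · exact hK₂ _ (hc.transfer (c.edges_mem_of_closed h₂ hv).2)

variable {F F₁ F₂ : SimpleGraph V} {A : Set F.ConnectedComponent}

theorem mk_mem_iff_of_adj (h₁ : ∀ v, F.connectedComponentMk v ∉ A → ∀ x, F₁.Adj v x ↔ F.Adj v x)
    {x y : V} (h : F₁.Adj x y) : F.connectedComponentMk x ∈ A ↔ F.connectedComponentMk y ∈ A := by
  constructor
  · intro hx
    by_contra hy
    exact hy (mk_eq_of_adj ((h₁ y hy x).1 h.symm) ▸ hx)
  · intro hy
    by_contra hx
    exact hx (mk_eq_of_adj ((h₁ x hx y).1 h) ▸ hy)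

variable [Fintype V] {G : SimpleGraph V}

/-- Two end vertices produced in complementary sets of components are not adjacent. -/
theorem IsOptimal.not_adj_of_isReroute (hF : IsOptimal G F) {S₁ S₂ : Set V} {l₁ l₂ : ℕ} {u v : V}
    (h₁ : IsReroute G F A S₁ l₁ u F₁) (h₂ : IsReroute G F Aᶜ S₂ l₂ v F₂)
    (hu : F.connectedComponentMk u ∈ A) (hv : F.connectedComponentMk v ∈ Aᶜ) : ¬ G.Adj u v := by
  have hm₁ := h₁.adj_iff_of_mk_notMem
  have hm₂ := h₂.adj_iff_of_mk_notMem
  let H : SimpleGraph V :=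
    { Adj := fun x y => (F.connectedComponentMk x ∈ A ∧ F₁.Adj x y) ∨
        (F.connectedComponentMk x ∉ A ∧ F₂.Adj x y)
      symm := ⟨by
        rintro x y (⟨hx, h⟩ | ⟨hx, h⟩)
        · exact Or.inl ⟨(mk_mem_iff_of_adj hm₁ h).1 hx, h.symm⟩
        · exact Or.inr ⟨(mk_mem_iff_of_adj hm₂ h).1 hx, h.symm⟩⟩
      loopless := ⟨by
        rintro x (⟨_, h⟩ | ⟨_, h⟩)
        · exact h.ne rfl
        · exact h.ne rfl⟩ }
  have hH₁ : ∀ x, F.connectedComponentMk x ∈ A → ∀ y, H.Adj x y ↔ F₁.Adj x y := by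
    intro x hx y
    simp [H, hx]
  have hH₂ : ∀ x, F.connectedComponentMk x ∉ A → ∀ y, H.Adj x y ↔ F₂.Adj x y := by
    intro x hx y
    simp [H, hx]
  have hc₁ : ∀ x y, x ∈ {x | F.connectedComponentMk x ∈ A} → H.Adj x y →
      y ∈ {x | F.connectedComponentMk x ∈ A} ∧ F₁.Adj x y := by
    intro x y hx h
    rw [hH₁ x hx] at h
    exact ⟨(mk_mem_iff_of_adj hm₁ h).1 hx, h⟩
  have hc₂ : ∀ x y, x ∈ {x | F.connectedComponentMk x ∈ A}ᶜ → H.Adj x y →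
      y ∈ {x | F.connectedComponentMk x ∈ A}ᶜ ∧ F₂.Adj x y := by
    intro x y hx h
    rw [hH₂ x hx] at h
    exact ⟨(mk_mem_iff_of_adj hm₂ h).1 hx, h⟩
  have hd₁ : ∀ x, F.connectedComponentMk x ∈ A → H.ndeg x = F₁.ndeg x :=
    fun x hx => ndeg_congr (hH₁ x hx)
  have hd₂ : ∀ x, F.connectedComponentMk x ∉ A → H.ndeg x = F₂.ndeg x :=
    fun x hx => ndeg_congr (hH₂ x hx)
  have hH : IsPathForest G H := by
    refine ⟨?_, isAcyclic_of_closed h₁.isPathForest.acyclic h₂.isPathForest.acyclic hc₁ hc₂, ?_⟩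
    · rintro x y (⟨_, h⟩ | ⟨_, h⟩)
      · exact h₁.isPathForest.le h
      · exact h₂.isPathForest.le h
    · intro x
      by_cases hx : F.connectedComponentMk x ∈ A
      · rw [hd₁ x hx]; exact h₁.isPathForest.ndeg_le x
      · rw [hd₂ x hx]; exact h₂.isPathForest.ndeg_le x
  -- At each vertex `H` has the degree of one of `F₁`, `F₂`, and the other has the degree of `F`.
  have hsum : H.degSum + F.degSum = F₁.degSum + F₂.degSum := by
    unfold degSum
    rw [← Finset.sum_add_distrib, ← Finset.sum_add_distrib]
    refine Finset.sum_congr rfl fun x _ => ?_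
    by_cases hx : F.connectedComponentMk x ∈ A
    · rw [hd₁ x hx, ndeg_congr (hm₂ x (fun h => h hx))]
    · rw [hd₂ x hx, ndeg_congr (hm₁ x hx), add_comm]
  have hdeg : H.degSum = F.degSum := by
    have := h₁.degSum_eq
    have := h₂.degSum_eq
    omega
  refine hF.not_adj hH hdeg (hd₁ u hu ▸ h₁.ndeg_le) (hd₂ v hv ▸ h₂.ndeg_le) ?_
  rintro ⟨p⟩
  exact hv (p.edges_mem_of_closed hc₁ hu).1

theorem IsPathForest.ncard_le_of_subset {F : SimpleGraph V} (hF : IsPathForest G F) {S T : Set V}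
    (h : ∀ y ∈ S, y ∈ T ∨ ∃ u, F.Adj u y ∧ u ∈ T) : S.ncard ≤ 3 * T.ncard := by
  classical
  have h1 : S.toFinset ⊆ T.toFinset.biUnion fun u => insert u (F.neighborSet u).toFinset := by
    intro y hy
    rw [Set.mem_toFinset] at hy
    rw [Finset.mem_biUnion]
    rcases h y hy with h | ⟨u, h, hu⟩
    · exact ⟨y, by simpa using h, Finset.mem_insert_self _ _⟩
    · exact ⟨u, by simpa using hu, by simp [h]⟩
  rw [Set.ncard_eq_toFinset_card', Set.ncard_eq_toFinset_card', mul_comm]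
  refine (Finset.card_le_card h1).trans (Finset.card_biUnion_le_card_mul _ _ _ fun u _ => ?_)
  refine (Finset.card_insert_le _ _).trans ?_
  have := hF.ndeg_le u
  rw [ndeg, Set.ncard_eq_toFinset_card'] at this
  omega

end Combine

/-! ### Bounding the number of paths -/

section Components

variable {V : Type*} {G F : SimpleGraph V} {r : F.ConnectedComponent → V}

theorem IsRoot.injective (hr : IsRoot F r) : Function.Injective r := fun c d h => by
  rw [← (hr c).1, ← (hr d).1, h]

variable [Fintype V]

theorem IsRoot.sum_compSize [Fintype F.ConnectedComponent] (hr : IsRoot F r) :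
    ∑ c, F.compSize (r c) = Fintype.card V := by
  classical
  rw [← Finset.card_univ, Finset.card_eq_sum_card_fiberwise (f := F.connectedComponentMk)
    (t := Finset.univ) (fun _ _ => Finset.mem_coe.2 (Finset.mem_univ _))]
  refine Finset.sum_congr rfl fun c _ => ?_
  rw [compSize, Set.ncard_eq_toFinset_card']
  congr 1
  ext x
  simp only [Set.mem_toFinset, Set.mem_ofPred_eq, Finset.mem_filter, Finset.mem_univ, true_and]
  rw [← ConnectedComponent.eq, (hr c).1, eq_comm]

/-- Markov's inequality: the average component size is n/k. -/
theorem IsRoot.card_le_two_mul_card_filter [Fintype F.ConnectedComponent] (hr : IsRoot F r) :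
    Fintype.card F.ConnectedComponent ≤ 2 * Finset.card {c | F.compSize (r c) ≤
      2 * Fintype.card V / Fintype.card F.ConnectedComponent} := by
  classical
  have hsum := hr.sum_compSize
  set n := Fintype.card V
  set k := Fintype.card F.ConnectedComponent with hk
  set l := 2 * n / k
  rcases Nat.eq_zero_or_pos k with h0 | hpos
  · omega
  have h1 : Finset.card {c | ¬ F.compSize (r c) ≤ l} * (l + 1) ≤ n := by
    rw [← hsum, ← smul_eq_mul]
    refine (Finset.card_nsmul_le_sum _ (fun c => F.compSize (r c)) _ ?_).trans
      (Finset.sum_le_sum_of_subset (Finset.subset_univ _))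
    intro c hc
    rw [Finset.mem_filter] at hc
    omega
  have h2 : 2 * n < k * (l + 1) := by
    exact Nat.lt_mul_div_succ _ hpos
  have h3 := Finset.card_filter_add_card_filter_not (s := Finset.univ)
    (fun c => F.compSize (r c) ≤ l)
  rw [Finset.card_univ, ← hk] at h3
  generalize Finset.card {c | ¬ F.compSize (r c) ≤ l} = m at h1 h3
  have h4 : 2 * m ≤ k := by
    by_contra h
    push Not at h
    nlinarith
  omega

theorem exists_le_pow_mul_le {n k : ℕ} (hk : 0 < k) (hkn : k ≤ n) :
    ∃ t, n ≤ 100 ^ t * k ∧ 100 ^ t * k ≤ 100 * n := by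
  have hex : ∃ t, n ≤ 100 ^ t * k := by
    refine ⟨n, ?_⟩
    have : n < 100 ^ n := Nat.lt_pow_self (by norm_num)
    nlinarith
  classical
  refine ⟨Nat.find hex, Nat.find_spec hex, ?_⟩
  cases h : Nat.find hex with
  | zero => omega
  | succ t =>
    have := Nat.find_min hex (m := t) (by omega)
    rw [pow_succ]
    linarith

/-- Percolation with components as blocks and `X` the short ones. With 100^t about n/k and l about
2n/k, each block meets a neighbourhood in O(n²/k²) vertices, so the squares sum to O(n³/k²), which
`hk` turns into O(k²). The error is then O(k), comparable to `X`. -/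
theorem IsOptimal.exists_large_levels (hF : IsOptimal G F) (hr : IsRoot F r) {C : ℝ}
    (hC : 10 ^ 10 < C) (hG : G.IsExpander C) (hn : 2 * C < Fintype.card V)
    (hk : Fintype.card V ^ 3 ≤ Nat.card F.ConnectedComponent ^ 4) :
    ∃ (l t : ℕ) (A : Set F.ConnectedComponent),
      (Fintype.card V : ℝ) / (2 * C) ≤ (level G r l t A).ncard ∧
      (Fintype.card V : ℝ) / (2 * C) ≤ (level G r l t Aᶜ).ncard := by
  classical
  have : Fintype F.ConnectedComponent := Fintype.ofFinite _
  rw [Nat.card_eq_fintype_card] at hk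
  have hX := hr.card_le_two_mul_card_filter
  have hsum := hr.sum_compSize
  set n := Fintype.card V with hndef
  set k := Fintype.card F.ConnectedComponent with hkdef
  set l := 2 * n / k with hl
  set X : Finset F.ConnectedComponent := {c | F.compSize (r c) ≤ l} with hXdef
  have hn' : (2 * 10 ^ 10 : ℝ) < n := by linarith
  have hn' : 2 * 10 ^ 10 < n := by exact_mod_cast hn'
  have hk200 : 200 ≤ k := by
    by_contra h
    have h1 : k ^ 4 ≤ 200 ^ 4 := Nat.pow_le_pow_left (by omega) 4
    have h2 : n ^ 1 ≤ n ^ 3 := Nat.pow_le_pow_right (by omega) (by omega)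
    rw [pow_one] at h2
    omega
  have hkn : k ≤ n := Fintype.card_le_of_injective r hr.injective
  obtain ⟨t, ht1, ht2⟩ := exists_le_pow_mul_le (by omega : 0 < k) hkn
  have hl1 : 1 ≤ l := by
    rw [hl, Nat.le_div_iff_mul_le (by omega)]; omega
  have hlk : l * k ≤ 2 * n := Nat.div_mul_le_self _ _
  let lam : F.ConnectedComponent → ℕ := fun b =>
    {v | F.connectedComponentMk v = b ∧ Shallow r (5 * (100 ^ t * l) + 1) v}.ncard
  set H := 12 * (100 ^ t * l) with hH
  -- 2(5x + 1) ≤ 12x for x = 100^t l ≥ 1.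
  have hlamH : ∀ b, lam b ≤ H := by
    intro b
    refine (ncard_shallow_le hF.isPathForest hr _ b).trans ?_
    have : 1 ≤ 100 ^ t * l := Nat.mul_pos (by positivity) hl1
    omega
  have hlamsum : ∑ b, lam b ≤ n := by
    rw [← hsum]
    refine Finset.sum_le_sum fun b _ => Set.ncard_le_ncard ?_ (Set.toFinite _)
    rintro v ⟨hv, _⟩
    exact ConnectedComponent.exact ((hr b).1.trans hv.symm)
  have hlamsq : ∑ b, lam b ^ 2 ≤ H * n := by
    calc ∑ b, lam b ^ 2 ≤ ∑ b, H * lam b := Finset.sum_le_sum fun b _ => by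
          rw [pow_two]; exact Nat.mul_le_mul_right _ (hlamH b)
      _ ≤ H * n := by rw [← Finset.mul_sum]; exact Nat.mul_le_mul_left _ hlamsum
  have hHn : H * n ≤ 2400 * k ^ 2 := by
    have h1 : H * n * k ^ 2 ≤ 2400 * k ^ 2 * k ^ 2 := by
      calc H * n * k ^ 2 = 12 * n * (100 ^ t * k) * (l * k) := by rw [hH]; ring
        _ ≤ 12 * n * (100 * n) * (2 * n) := by gcongr
        _ = 2400 * n ^ 3 := by ring
        _ ≤ 2400 * k ^ 4 := by gcongr
        _ = _ := by ring
    exact Nat.le_of_mul_le_mul_right h1 (by positivity)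
  obtain ⟨A, hA1, hA2⟩ := exists_le_card_and_le_card_compl F.connectedComponentMk t
    (fun s A => (level G r l s (A : Set F.ConnectedComponent)).toFinset)
    (fun s A => {y | ∃ z ∈ level G r l s (A : Set F.ConnectedComponent), G.Adj z y})
    C (n / (2 * C)) (by linarith)
    (by
      intro A B hAB
      exact Set.toFinset_mono (level_mono t (Finset.coe_subset.2 hAB)))
    (fun s hs A => Set.toFinset_mono (level_subset_level hs))
    (by
      intro s _ A B hAB y hy
      simp only [Finset.mem_filter, Finset.mem_univ, true_and] at hy ⊢
      obtain ⟨z, hz, h⟩ := hy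
      exact ⟨z, level_mono s (Finset.coe_subset.2 hAB) hz, h⟩)
    (by
      intro s _ A
      rw [← Set.ncard_eq_toFinset_card', ← Set.ncard_coe_finset]
      refine hF.isPathForest.ncard_le_of_subset fun y hy => ?_
      simp only [Finset.coe_filter, Finset.mem_filter, Finset.mem_univ, true_and,
        Set.mem_ofPred_eq] at hy
      obtain ⟨⟨z, hz, hzy⟩, hyA⟩ := hy
      exact hF.exists_mem_level_succ hr hz hzy hyA)
    (fun b => (lam b : ℝ))
    (by
      intro s hs A b
      rw [← Set.ncard_coe_finset]
      refine Nat.cast_le.2 (Set.ncard_le_ncard ?_ (Set.toFinite _))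
      intro y hy
      simp only [Finset.coe_filter, Finset.mem_filter, Finset.mem_univ, true_and,
        Set.mem_ofPred_eq] at hy
      obtain ⟨⟨z, hz, hzy⟩, hyb⟩ := hy
      refine ⟨hyb, (hF.shallow_of_adj_level hr hz hzy).mono ?_⟩
      gcongr
      · omega
      · exact hs)
    (by
      intro s _ A h
      rw [← Set.ncard_eq_toFinset_card'] at h ⊢
      refine (hG.expansion _ h).trans ?_
      rw [← Set.ncard_coe_finset]
      refine Nat.cast_le.2 (Set.ncard_le_ncard ?_ (Set.toFinite _))
      rintro y ⟨_, z, hz, h⟩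
      simp only [Finset.coe_filter, Finset.mem_univ, true_and, Set.mem_ofPred_eq]
      exact ⟨z, hz, h⟩)
    X
    (by
      intro A
      rw [← Finset.card_image_of_injective _ hr.injective]
      refine Finset.card_le_card ?_
      intro v hv
      simp only [Finset.mem_image, Finset.mem_inter, hXdef, Finset.mem_filter, Finset.mem_univ,
        true_and] at hv
      obtain ⟨c, ⟨h1, h2⟩, rfl⟩ := hv
      rw [Set.mem_toFinset]
      exact ⟨by rw [(hr c).1], by rw [(hr c).1]; exact h2, h1⟩)
    (by omega)
    (by
      have h1 : ((∑ b, lam b ^ 2 : ℕ) : ℝ) ≤ (2400 * k ^ 2 : ℕ) :=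
        Nat.cast_le.2 (hlamsq.trans hHn)
      push_cast at h1
      have h2 : (k : ℝ) ≤ 2 * X.card := by exact_mod_cast hX
      have h3 : (0 : ℝ) ≤ k := by positivity
      refine (Real.sqrt_le_sqrt h1).trans ?_
      have h4 : √(2400 * (k : ℝ) ^ 2) ≤ 50 * k :=
        Real.sqrt_le_iff.2 ⟨by positivity, by nlinarith⟩
      have h5 : (1000 : ℝ) * (X.card / 5) ≤ (C - 600) * (X.card / 5) := by
        gcongr
        linarith
      linarith)
    (by
      have h2 : (k : ℝ) ≤ 2 * X.card := by exact_mod_cast hX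
      have h1 : (n : ℝ) ≤ 100 ^ t * k := by exact_mod_cast ht1
      have h3 : (100 : ℝ) ^ t * k ≤ 100 ^ t * (2 * X.card) := by gcongr
      have h4 : (n : ℝ) / (2 * C) ≤ n / 10 := by
        gcongr
        linarith
      linarith)
  refine ⟨l, t, A, ?_, ?_⟩
  · rw [Set.ncard_eq_toFinset_card']; exact hA1
  · rw [Set.ncard_eq_toFinset_card']
    simpa only [Finset.coe_compl] using hA2

/-- Singletons are already large enough for the edge condition, so `G` is complete. -/
theorem IsExpander.adj_of_card_le {C : ℝ} (hC : 0 < C) (hG : G.IsExpander C)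
    (hn : Fintype.card V ≤ 2 * C) {u v : V} (h : u ≠ v) : G.Adj u v := by
  have h1 : (Fintype.card V : ℝ) / (2 * C) ≤ 1 := by
    rw [div_le_one (by positivity)]; exact hn
  obtain ⟨x, rfl, y, rfl, hxy⟩ := hG.exists_adj {u} {v} (by simpa using h) (by simpa using h1)
    (by simpa using h1)
  exact hxy

theorem IsOptimal.card_connectedComponent_le_one (hF : IsOptimal G F) {C : ℝ} (hC : 0 < C)
    (hG : G.IsExpander C) (hn : Fintype.card V ≤ 2 * C) :
    Nat.card F.ConnectedComponent ≤ 1 := by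
  rw [Finite.card_le_one_iff_subsingleton]
  refine ⟨fun c d => ?_⟩
  by_contra hcd
  obtain ⟨u, rfl, hu⟩ := hF.isPathForest.acyclic.exists_ndeg_le_one c
  obtain ⟨v, rfl, hv⟩ := hF.isPathForest.acyclic.exists_ndeg_le_one d
  have hr : ¬ F.Reachable u v := fun h => hcd (ConnectedComponent.sound h)
  exact hF.not_adj hF.isPathForest rfl hu hv hr
    (hG.adj_of_card_le hC hn fun h => hr (h ▸ Reachable.refl _))

theorem IsOptimal.card_connectedComponent_le (hF : IsOptimal G F) {C : ℝ} (hC : 10 ^ 10 < C)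
    (hG : G.IsExpander C) :
    (Nat.card F.ConnectedComponent : ℝ) ≤ (Fintype.card V : ℝ) ^ (0.8 : ℝ) := by
  have h3 : (3 : ℝ) ≤ Fintype.card V := by exact_mod_cast hG.three_le_card
  rcases le_or_gt (Fintype.card V : ℝ) (2 * C) with hn | hn
  · have h1 : (Nat.card F.ConnectedComponent : ℝ) ≤ 1 := by
      exact_mod_cast hF.card_connectedComponent_le_one (by linarith) hG hn
    exact h1.trans (Real.one_le_rpow (by linarith) (by norm_num))
  by_contra hk
  push Not at hk
  choose r hr using fun c => hF.isPathForest.acyclic.exists_ndeg_le_one c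
  have hr : IsRoot F r := hr
  have hkn : Nat.card F.ConnectedComponent ≤ Fintype.card V := by
    rw [← Nat.card_eq_fintype_card]
    exact Nat.card_le_card_of_injective r hr.injective
  have hk5 : (Fintype.card V : ℝ) ^ 4 ≤ (Nat.card F.ConnectedComponent : ℝ) ^ 5 := by
    have h1 := pow_le_pow_left₀ (by positivity) hk.le 5
    rw [← Real.rpow_natCast, ← Real.rpow_mul (by positivity)] at h1
    rw [show (0.8 : ℝ) * (5 : ℕ) = (4 : ℕ) by norm_num, Real.rpow_natCast] at h1
    exact h1
  -- n⁴ ≤ k⁵ ≤ k⁴n; the exponent 3/4 is all that is needed from here on.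
  have hk4 : Fintype.card V ^ 3 ≤ Nat.card F.ConnectedComponent ^ 4 := by
    have h1 : Fintype.card V ^ 4 ≤ Nat.card F.ConnectedComponent ^ 5 := by exact_mod_cast hk5
    have h2 : Fintype.card V ^ 3 * Fintype.card V ≤
        Nat.card F.ConnectedComponent ^ 4 * Fintype.card V :=
      calc Fintype.card V ^ 3 * Fintype.card V = Fintype.card V ^ 4 := by ring
        _ ≤ Nat.card F.ConnectedComponent ^ 4 * Nat.card F.ConnectedComponent := by
          rw [← pow_succ]; exact h1
        _ ≤ _ := by gcongr
    exact Nat.le_of_mul_le_mul_right h2 (by have := hG.three_le_card; omega)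
  obtain ⟨l, t, A, h1, h2⟩ := hF.exists_large_levels hr hC hG hn hk4
  obtain ⟨u, hu, v, hv, huv⟩ := hG.exists_adj _ _ (by
    rw [Set.disjoint_left]
    intro x hx hx'
    exact mk_mem_of_mem_level hx' (mk_mem_of_mem_level hx)) h1 h2
  obtain ⟨F₁, h₁⟩ := exists_isReroute_of_mem_level hF.isPathForest hr hu
  obtain ⟨F₂, h₂⟩ := exists_isReroute_of_mem_level hF.isPathForest hr hv
  exact hF.not_adj_of_isReroute h₁ h₂ (mk_mem_of_mem_level hu) (mk_mem_of_mem_level hv) huv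

end Components

/-! ### Excluding isolated vertices -/

section Isolated

variable {V : Type*} [Fintype V] {G F F' : SimpleGraph V} {S T : Set V} {z y : V}

/-- `F'` is a path forest which is as good as `F`, has the same inner vertices, differs from `F`
only near `S`, and has `z` as an isolated vertex. -/
structure Isolates (G F : SimpleGraph V) (S : Set V) (z : V) (F' : SimpleGraph V) : Prop where
  isPathForest : IsPathForest G F'
  degSum_eq : F'.degSum = F.degSum
  sqrtSum_eq : F'.sqrtSum = F.sqrtSum
  ndeg_eq_zero : F'.ndeg z = 0
  ndeg_eq_two_iff : ∀ v, F'.ndeg v = 2 ↔ F.ndeg v = 2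
  adj_iff : ∀ v, v ∉ S → (∀ u, F.Adj v u → u ∉ S) → ∀ x, F'.Adj v x ↔ F.Adj v x

theorem Isolates.mono (h : Isolates G F S z F') (hST : S ⊆ T) : Isolates G F T z F' :=
  { h with
    adj_iff := fun v hv hu => h.adj_iff v (fun h' => hv (hST h')) fun u huv h' =>
      hu u huv (hST h') }

theorem not_adj_of_ndeg_eq_zero (h : F.ndeg z = 0) (x : V) : ¬ F.Adj z x := by
  rw [ndeg, Set.ncard_eq_zero (Set.toFinite _)] at h
  exact fun hx => (Set.ext_iff.1 h x).1 hx

theorem not_reachable_of_ndeg_eq_zero (h : F.ndeg z = 0) (hne : z ≠ y) : ¬ F.Reachable z y := by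
  rintro ⟨p⟩
  cases p with
  | nil => exact hne rfl
  | cons hadj _ => exact not_adj_of_ndeg_eq_zero h _ hadj

theorem ndeg_eq_zero_iff_compSize_eq_one : F.ndeg z = 0 ↔ F.compSize z = 1 := by
  constructor
  · intro h
    rw [compSize, Set.ncard_eq_one]
    refine ⟨z, Set.eq_singleton_iff_unique_mem.2 ⟨Reachable.refl z, fun x hx => ?_⟩⟩
    by_contra hne
    exact not_reachable_of_ndeg_eq_zero h (Ne.symm hne) hx
  · intro h
    rw [compSize, Set.ncard_eq_one] at h
    obtain ⟨a, ha⟩ := h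
    rw [ndeg, Set.ncard_eq_zero (Set.toFinite _), Set.eq_empty_iff_forall_notMem]
    intro x hx
    have h1 : x ∈ ({a} : Set V) := ha ▸ (Adj.reachable hx)
    have h2 : z ∈ ({a} : Set V) := ha ▸ (Reachable.refl z)
    exact (show F.Adj z x from hx).ne (h2.trans h1.symm)

theorem Isolates.ndeg_eq_two (hF : IsOptimal G F) (h : Isolates G F S z F') (hzy : G.Adj z y) :
    F.ndeg y = 2 := by
  rw [← h.ndeg_eq_two_iff]
  by_contra hy
  have := h.isPathForest.ndeg_le y
  have := h.ndeg_eq_zero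
  exact hF.not_adj h.isPathForest h.degSum_eq (by omega) (by omega)
    (not_reachable_of_ndeg_eq_zero h.ndeg_eq_zero hzy.ne) hzy

/-- After squaring, this is a + b < a(1 + b). -/
theorem one_add_sqrt_add_lt {a b : ℝ} (ha : 1 < a) (hb : 0 < b) : 1 + √(b + a) < √a + √(1 + b) := by
  have h1 := Real.sq_sqrt (show 0 ≤ a by linarith)
  have h2 := Real.sq_sqrt (show 0 ≤ 1 + b by linarith)
  have h3 := Real.sq_sqrt (show 0 ≤ b + a by linarith)
  have h4 : √(b + a) < √a * √(1 + b) := by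
    rw [← Real.sqrt_mul (by linarith)]
    exact Real.sqrt_lt_sqrt (by linarith) (by nlinarith)
  refine lt_of_pow_lt_pow_left₀ 2 (by positivity) ?_
  nlinarith

/-- Since `y` has degree two, `z` can be attached to it in place of a neighbour `w`. If the piece
cut off at `w` had more than one vertex, the sum of square roots would increase; so `w` becomes
isolated and the sum is unchanged. -/
theorem Isolates.exists_isolates (hF : IsOptimal G F) (h : Isolates G F S z F') (hz : z ∈ S)
    (hzy : G.Adj z y) (hy : y ∉ S) (hyS : ∀ u, F.Adj y u → u ∉ S) :
    ∃ w, w ∉ S ∧ ∃ F'', Isolates G F (insert w S) w F'' := by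
  have hac := h.isPathForest.acyclic
  have hz0 := h.ndeg_eq_zero
  have hy2 := (h.ndeg_eq_two_iff y).2 (h.ndeg_eq_two hF hzy)
  obtain ⟨w, hw⟩ := Set.nonempty_of_ncard_ne_zero
    (show (F'.neighborSet y).ncard ≠ 0 by unfold ndeg at hy2; omega)
  have hyw : F'.Adj y w := hw
  have hyw' : F.Adj y w := (h.adj_iff y hy hyS w).1 hyw
  have hn : ¬ F'.Adj z y := not_adj_of_ndeg_eq_zero hz0 y
  have hzw : z ≠ w := fun e => not_adj_of_ndeg_eq_zero hz0 y (e ▸ hyw.symm)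
  have hHz : (F'.deleteEdges {s(y, w)}).ndeg z = 0 := by
    have := Set.ncard_le_ncard (neighborSet_mono (deleteEdges_le (G := F') {s(y, w)}) z)
      (Set.toFinite _)
    unfold ndeg at hz0 ⊢
    omega
  have hnr := not_reachable_of_ndeg_eq_zero hHz hzy.ne
  have hpf := h.isPathForest.rotate (by omega) hzy hn hyw hnr
  have hdeg := (degSum_rotate hac hzy.ne hyw hnr).trans h.degSum_eq
  have hle := hF.sqrtSum_le _ hpf hdeg
  have hsq := sqrtSum_rotate hac hyw hnr rfl rfl rfl
  rw [ndeg_eq_zero_iff_compSize_eq_one.1 hHz, h.sqrtSum_eq, Nat.cast_one, Real.sqrt_one] at hsq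
  have ha : (F'.deleteEdges {s(y, w)}).compSize w = 1 := by
    by_contra hne
    have h1 := compSize_pos (F'.deleteEdges {s(y, w)}) w
    have h2 := compSize_pos (F'.deleteEdges {s(y, w)}) y
    have h3 := one_add_sqrt_add_lt (a := (F'.deleteEdges {s(y, w)}).compSize w)
      (b := (F'.deleteEdges {s(y, w)}).compSize y) (by exact_mod_cast (by omega))
      (by exact_mod_cast h2)
    linarith
  have hw0 : (F'.rotate z y w).ndeg w = 0 := by
    rw [ndeg_eq_zero_iff_compSize_eq_one, rotate, compSize_sup_edge_of_not_reachable hzy.ne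
      (not_reachable_of_ndeg_eq_zero hHz hzw) (hac.not_reachable_deleteEdges hyw), ha]
  refine ⟨w, hyS w hyw', F'.rotate z y w, hpf, hdeg, ?_, hw0, ?_, ?_⟩
  · rw [hsq, ha, Nat.cast_one, Real.sqrt_one, add_comm ((_ : ℕ) : ℝ) 1]
    ring
  · intro v
    rw [← h.ndeg_eq_two_iff v]
    by_cases hvy : v = y
    · rw [hvy, ndeg_rotate_mid hac hzy.ne hyw hnr]
    by_cases hvw : v = w
    · have := ndeg_rotate_right hac hn hyw
      rw [hvw]
      omega
    by_cases hvz : v = z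
    · classical
      rw [hvz, rotate, ndeg_sup_edge (fun h => hnr h.reachable) hzy.ne, hHz, hz0]
      simp [hzy.ne]
    · rw [ndeg_congr (rotate_adj_iff hvz hvy hvw)]
  · intro v hv hvu x
    rw [rotate_adj_iff, h.adj_iff v (fun h => hv (Set.mem_insert_of_mem _ h))
      fun u hu h => hvu u hu (Set.mem_insert_of_mem _ h)]
    · rintro rfl; exact hv (Set.mem_insert_of_mem _ hz)
    · rintro rfl; exact hvu w hyw' (Set.mem_insert _ _)
    · rintro rfl; exact hv (Set.mem_insert _ _)

/-- In a large expander, no nonempty independent set has only few neighbours. -/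
theorem IsExpander.exists_adj_of_ncard_le {C : ℝ} (hC : 10 ^ 10 < C) (hG : G.IsExpander C)
    (hn : 2 * C < Fintype.card V) (hS : S.Nonempty)
    (hcard : (G.outerNeighborSet S).ncard ≤ 3 * S.ncard) : ∃ x ∈ S, ∃ y ∈ S, G.Adj x y := by
  set n : ℝ := (Fintype.card V : ℝ) with hndef
  have hpos : (0 : ℝ) < S.ncard := by exact_mod_cast (Set.ncard_pos (Set.toFinite _)).2 hS
  have hcard' : ((G.outerNeighborSet S).ncard : ℝ) ≤ 3 * S.ncard := by exact_mod_cast hcard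
  have hS1 : n / (2 * C) ≤ S.ncard := by
    by_contra h
    push Not at h
    have := hG.expansion S h
    nlinarith
  -- No edge of `G` joins `S` to the vertices outside `S` and its neighbourhood. Hence `S` has
  -- nearly n/4 vertices, enough to split it into two sets of size at least n/(2C).
  have hY : ((S ∪ G.outerNeighborSet S)ᶜ.ncard : ℝ) < n / (2 * C) := by
    by_contra h
    push Not at h
    obtain ⟨x, hx, y, hy, hxy⟩ := hG.exists_adj S _
      (Set.disjoint_compl_right_iff_subset.2 Set.subset_union_left) hS1 h
    exact hy (Or.inr ⟨fun h => hy (Or.inl h), x, hx, hxy⟩)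
  have hsum : n ≤ 4 * S.ncard + (S ∪ G.outerNeighborSet S)ᶜ.ncard := by
    have h1 := Set.ncard_add_ncard_compl (S ∪ G.outerNeighborSet S)
    have h2 := Set.ncard_union_le S (G.outerNeighborSet S)
    rw [Nat.card_eq_fintype_card] at h1
    rw [hndef]
    exact_mod_cast (by omega)
  have hn1 : 1 < n / (2 * C) := by rwa [one_lt_div (by linarith)]
  have hn2 : n / (2 * C) ≤ n / 100 := by
    gcongr
    linarith
  have hceil := Nat.ceil_lt_add_one (show 0 ≤ n / (2 * C) by linarith)
  obtain ⟨T, hTS, hT⟩ := Set.exists_subset_card_eq (s := S) (n := ⌈n / (2 * C)⌉₊)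
    (Nat.ceil_le.2 hS1)
  have hdiff := Set.ncard_sdiff_add_ncard_of_subset hTS
  have hdiff' : ((S \ T).ncard : ℝ) + T.ncard = S.ncard := by exact_mod_cast hdiff
  have hT' : (T.ncard : ℝ) = ⌈n / (2 * C)⌉₊ := by rw [hT]
  obtain ⟨x, hx, y, hy, hxy⟩ := hG.exists_adj T (S \ T) Set.disjoint_sdiff_right
    (by rw [hT']; exact Nat.le_ceil _) (by linarith)
  exact ⟨x, hTS hx, y, hy.1, hxy⟩

theorem IsOptimal.exists_adj (hF : IsOptimal G F) {C : ℝ} (hC : 10 ^ 10 < C)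
    (hG : G.IsExpander C) (v : V) : ∃ w, F.Adj v w := by
  by_contra hv
  push Not at hv
  have hv0 : F.ndeg v = 0 := by
    rw [ndeg, Set.ncard_eq_zero (Set.toFinite _), Set.eq_empty_iff_forall_notMem]
    exact hv
  rcases le_or_gt (Fintype.card V : ℝ) (2 * C) with hn | hn
  · have h1 := hF.card_connectedComponent_le_one (by linarith) hG hn
    rw [Finite.card_le_one_iff_subsingleton] at h1
    have := hG.three_le_card
    have : Nontrivial V := Fintype.one_lt_card_iff_nontrivial.1 (by omega)
    obtain ⟨u, hu⟩ := exists_ne v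
    exact not_reachable_of_ndeg_eq_zero hv0 hu.symm
      (ConnectedComponent.exact (Subsingleton.elim _ _))
  -- By maximality every `G`-neighbour of `S` is an `F`-neighbour of `S`; otherwise a rotation would
  -- enlarge `S`.
  obtain ⟨S, ⟨hgood, hS⟩, hmax⟩ := Set.exists_max_image
    {S : Set V | (∀ z ∈ S, ∃ F', Isolates G F S z F') ∧ S.Nonempty} Set.ncard (Set.toFinite _)
    ⟨{v}, by
      rintro z rfl
      exact ⟨F, hF.isPathForest, rfl, rfl, hv0, fun _ => Iff.rfl, fun _ _ _ _ => Iff.rfl⟩,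
      Set.singleton_nonempty v⟩
  have hclosed : ∀ y ∈ G.outerNeighborSet S, y ∈ S ∨ ∃ u, F.Adj u y ∧ u ∈ S := by
    rintro y ⟨hy, z, hz, hzy⟩
    by_contra hcon
    push Not at hcon
    obtain ⟨F', hF'⟩ := hgood z hz
    obtain ⟨w, hw, F'', hF''⟩ := hF'.exists_isolates hF hz hzy hy fun u hu => hcon.2 u hu.symm
    have h1 := hmax (insert w S) ⟨?_, Set.insert_nonempty _ _⟩
    · rw [Set.ncard_insert_of_notMem hw] at h1
      omega
    · rintro x (rfl | hx)
      · exact ⟨F'', hF''⟩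
      · obtain ⟨K, hK⟩ := hgood x hx
        exact ⟨K, hK.mono (Set.subset_insert _ _)⟩
  obtain ⟨x, hx, y, hy, hxy⟩ := hG.exists_adj_of_ncard_le hC hn hS
    (hF.isPathForest.ncard_le_of_subset hclosed)
  obtain ⟨K, hK⟩ := hgood x hx
  obtain ⟨K', hK'⟩ := hgood y hy
  -- As a neighbour of `x`, the vertex `y` has degree two in `F`; but a vertex that can be isolated
  -- does not, since `Isolates` preserves the vertices of degree two.
  have h1 := hK.ndeg_eq_two hF hxy
  rw [← hK'.ndeg_eq_two_iff, hK'.ndeg_eq_zero] at h1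
  omega

end Isolated

end SimpleGraph

/-- A spanning linear forest of `G` is a linear forest `F ≤ G` on the whole vertex set of `G`. -/
theorem mainTheorem9 {V : Type*} [Fintype V] (G : SimpleGraph V) (C : ℝ) (hC : 10 ^ 10 < C)
    (hG : G.IsExpander C) :
    ∃ F : SimpleGraph V, F ≤ G ∧ F.IsLinearForest ∧
      (Nat.card F.ConnectedComponent : ℝ) ≤ (Fintype.card V : ℝ) ^ (0.8 : ℝ) ∧
      ∀ v : V, ∃ w : V, F.Adj v w := by
  obtain ⟨F, hF⟩ := SimpleGraph.exists_isOptimal G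
  exact ⟨F, hF.isPathForest.le, hF.isPathForest.isLinearForest,
    hF.card_connectedComponent_le hC hG, hF.exists_adj hC hG⟩
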